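/- Let $d\ge 1$ be odd and let $\sigma(z)=-z$. Let $R_d$ be the set of pairs $\alpha=(a,b)$ of jets in $\mathbb{C}[z]/(z^d)$ with $\sigma^*a=-a$, $\sigma^*b=b$ and order of vanishing $\mathrm{ord}_0(\alpha)<d/2$. Writing $a=x_1z+x_3z^3+\dots$, $b=x_0+x_2z^2+\dots$ identifies $R_d$ with a subset of $\mathbb{C}^d$. Let $\mathsf{Heck}_d=R_d/\!\sim$, where $\alpha\sim\alpha'$ if and only if $\mathrm{ord}_0(\alpha)=\mathrm{ord}_0(\alpha')=:n$ and $\alpha\equiv\alpha' \bmod z^{d-n}$. The group $G_D$ of units $\phi$ of $\mathbb{C}[z]/(z^d)$ with $\sigma^*\phi=\phi$ acts on $R_d$ and $\mathsf{Heck}_d$ by multiplication. For $0\le n\le\frac{d-1}{2}$ let $V_n\subset\mathsf{Heck}_d$ be the set of classes of order $n$. A subset of a weighted projective space $\mathbb{P}(w_0,\dots,w_m)$ is called a *toric subspace* if it is a locally closed subvariety (its set of homogeneous coordinate vectors is Zariski locally closed in $\mathbb{C}^{m+1}$) that is preserved by the torus acting by scaling of the coordinates, i.e. it is a locally closed union of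 torus orbits. A point of it is called nonsingular if $\mathbb{C}^*$ acts freely at its coordinate vectors. **Theorem.** The quotient $\mathsf{Heck}_d/G_D$ is a union of finitely many toric subspaces of weighted projective spaces glued algebraically along torus orbits. Precisely, there are finitely many subsets $N_i\subset\mathsf{Heck}_d$, $i\in I$, such that the sets $P\in\{V_n\}_{0\le n\le\frac{d-1}{2}}\cup\{N_i\}_{i\in I}$ have the following properties. 1. Each $P$ is the image in $\mathsf{Heck}_d$ of a connected, Zariski locally closed, $G_D$-stable set $\tilde P\subset R_d\subset\mathbb{C}^d$ of representatives (for $P=V_n$, of the set of all representatives). There is a $G_D$-invariant map $f_P$ from $P$ to a weighted projective space which is algebraic (on $\tilde P$ it is given in homogeneous coordinates by polynomials in $x_0,\dots,x_{d-1}$ without common zeros on $\tilde P$), which separates the $G_D$-orbits, and whose image is a toric subspace consisting of nonsingular points. 2. For $P=N_i$ the target is $\mathbb{P}(1,1,2,3,\dots,m_i)$ for some $m_i\ge1$. For $P=V_n$ the target is $\mathbb{P}^{\frac12(d-2n-1)}=\mathbb{P}(1,\dots,1)$ and the image is the affine chart $\{y_0\neq0\}$; in particular $V_{(d-1)/2}/G_D$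 is a point. 3. For all $0\le n<l\le\frac{d-1}{2}$ and $\alpha\in V_l$ there is an $i\in I$ with $\alpha\in N_i$ and $N_i\cap V_n\neq\emptyset$. 4. The sets $P/G_D$ cover $\mathsf{Heck}_d/G_D$. For any two of the sets, $P$ and $Q$, the image $f_P(P\cap Q)$ is a toric subspace of the target of $f_P$, and the coordinate change $f_P(P\cap Q)\to f_Q(P\cap Q)$ induced by $f_Q$ is given by polynomials in the homogeneous coordinates (without common zeros on the coordinate vectors of $f_P(P\cap Q)$). -/

import Mathlib

open Polynomial

noncomputable section

namespace HeckeModuli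

/-! ### Jets at a point and the involution `z ↦ -z` -/

/-- Polynomial germs on the divisor `d · 0`: the ring `O_0 / (z ^ d) = ℂ[z] / (z ^ d)`. -/
abbrev Jet (d : ℕ) : Type := AdjoinRoot (X ^ d : ℂ[X])

/-- The class of the coordinate `z`. -/
def zz (d : ℕ) : Jet d := AdjoinRoot.root (X ^ d : ℂ[X])

theorem zz_pow (d : ℕ) : zz d ^ d = 0 := by
  have h := AdjoinRoot.eval₂_root (X ^ d : ℂ[X])
  simpa [zz] using h

/-- Pullback of jets along the involution `z ↦ -z`. -/
def sigma (d : ℕ) : Jet d →ₐ[ℂ] Jet d :=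
  AdjoinRoot.liftAlgHom (X ^ d : ℂ[X]) (Algebra.ofId ℂ (Jet d)) (-zz d) (by
    rw [eval₂_X_pow, neg_pow, zz_pow, mul_zero])

/-- The `i`-th Taylor coefficient of a jet, for `i < d`. -/
def jetCoeff {d : ℕ} (i : Fin d) (f : Jet d) : ℂ :=
  (AdjoinRoot.modByMonicHom (monic_X_pow d) f).coeff i

/-! ### Hecke parameters -/

/-- The pair `(a, b)` of jets vanishes to order exactly `n`. -/
def HasOrd {d : ℕ} (a b : Jet d) (n : ℕ) : Prop :=
  (zz d ^ n ∣ a ∧ zz d ^ n ∣ b) ∧ ¬ (zz d ^ (n + 1) ∣ a ∧ zz d ^ (n + 1) ∣ b)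

theorem HasOrd.unique {d : ℕ} {a b : Jet d} {n k : ℕ} (h : HasOrd a b n) (h' : HasOrd a b k) :
    n = k := by
  rcases lt_trichotomy n k with hlt | heq | hgt
  · exact absurd ⟨(pow_dvd_pow _ hlt).trans h'.1.1, (pow_dvd_pow _ hlt).trans h'.1.2⟩ h.2
  · exact heq
  · exact absurd ⟨(pow_dvd_pow _ hgt).trans h.1.1, (pow_dvd_pow _ hgt).trans h.1.2⟩ h'.2

/-- A representative of a Hecke parameter: a pair of jets, `a` odd and `b` even under the
involution, with order of vanishing less than `d / 2`. -/
@[ext]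
structure HeckeRep (d : ℕ) where
  a : Jet d
  b : Jet d
  odd_a : sigma d a = -a
  even_b : sigma d b = b
  ord_lt : ∃ n, 2 * n < d ∧ HasOrd a b n

/-- The coefficients `x_0, …, x_{d-1}` in `a = x_1 z + x_3 z ^ 3 + ⋯` and
`b = x_0 + x_2 z ^ 2 + ⋯`; they identify the space of representatives with a subset of `ℂ ^ d`. -/
def HeckeRep.coords {d : ℕ} (α : HeckeRep d) : Fin d → ℂ :=
  fun i => if Odd (i : ℕ) then jetCoeff i α.a else jetCoeff i α.b

/-- Two representatives are equivalent if they have the same order `n` and agree modulo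
`z ^ (d - n)`. -/
instance heckeSetoid (d : ℕ) : Setoid (HeckeRep d) where
  r α β := ∃ n, HasOrd α.a α.b n ∧ HasOrd β.a β.b n ∧
    zz d ^ (d - n) ∣ α.a - β.a ∧ zz d ^ (d - n) ∣ α.b - β.b
  iseqv :=
    { refl := fun α => by
        obtain ⟨n, -, h⟩ := α.ord_lt
        exact ⟨n, h, h, by simp, by simp⟩
      symm := by
        rintro α β ⟨n, h, h', h1, h2⟩
        exact ⟨n, h', h, (dvd_sub_comm).1 h1, (dvd_sub_comm).1 h2⟩
      trans := by
        rintro α β γ ⟨n, h, h', h1, h2⟩ ⟨k, g, g', g1, g2⟩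
        obtain rfl := h'.unique g
        refine ⟨n, h, g', ?_, ?_⟩
        · have := dvd_add h1 g1
          rwa [sub_add_sub_cancel] at this
        · have := dvd_add h2 g2
          rwa [sub_add_sub_cancel] at this }

/-- The space `Heck_d` of Hecke parameters at a zero of order `d`. -/
abbrev Heck (d : ℕ) : Type := Quotient (heckeSetoid d)

/-- The group `G_D` of invertible jets that are invariant under the involution. -/
def jetGroup (d : ℕ) : Subgroup (Jet d)ˣ where
  carrier := {φ | sigma d (φ : Jet d) = φ}
  mul_mem' := by
    intro φ ψ hφ hψ
    simp only [Set.mem_ofPred_eq] at *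
    rw [Units.val_mul, map_mul, hφ, hψ]
  one_mem' := by simp
  inv_mem' := by
    intro φ hφ
    simp only [Set.mem_ofPred_eq] at *
    have h1 : sigma d (φ : Jet d) * sigma d ((φ⁻¹ : (Jet d)ˣ) : Jet d) = 1 := by
      rw [← map_mul, Units.mul_inv, map_one]
    rw [hφ] at h1
    exact (Units.inv_eq_of_mul_eq_one_right h1).symm

theorem jetGroup_dvd {d : ℕ} (φ : (Jet d)ˣ) (x y : Jet d) : x ∣ (φ : Jet d) * y ↔ x ∣ y :=
  φ.isUnit.dvd_mul_left

theorem HasOrd.smul {d : ℕ} {a b : Jet d} {n : ℕ} (h : HasOrd a b n) (φ : (Jet d)ˣ) :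
    HasOrd ((φ : Jet d) * a) ((φ : Jet d) * b) n := by
  unfold HasOrd at *
  simpa only [jetGroup_dvd] using h

/-- `G_D` acts on representatives by multiplication of both entries. -/
instance (d : ℕ) : MulAction (jetGroup d) (HeckeRep d) where
  smul φ α :=
    { a := (φ : (Jet d)ˣ) * α.a
      b := (φ : (Jet d)ˣ) * α.b
      odd_a := by
        have hφ : sigma d ((φ : (Jet d)ˣ) : Jet d) = ((φ : (Jet d)ˣ) : Jet d) := φ.2
        rw [map_mul, hφ, α.odd_a, mul_neg]
      even_b := by
        have hφ : sigma d ((φ : (Jet d)ˣ) : Jet d) = ((φ : (Jet d)ˣ) : Jet d) := φ.2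
        rw [map_mul, hφ, α.even_b]
      ord_lt := by
        obtain ⟨n, hn, h⟩ := α.ord_lt
        exact ⟨n, hn, h.smul _⟩ }
  one_smul α := by
    apply HeckeRep.ext
    · exact one_mul α.a
    · exact one_mul α.b
  mul_smul φ ψ α := by
    apply HeckeRep.ext
    · exact mul_assoc ((φ : (Jet d)ˣ) : Jet d) ((ψ : (Jet d)ˣ) : Jet d) α.a
    · exact mul_assoc ((φ : (Jet d)ˣ) : Jet d) ((ψ : (Jet d)ˣ) : Jet d) α.b

theorem heckeRep_smul_a {d : ℕ} (φ : jetGroup d) (α : HeckeRep d) :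
    (φ • α).a = ((φ : (Jet d)ˣ) : Jet d) * α.a := rfl

theorem heckeRep_smul_b {d : ℕ} (φ : jetGroup d) (α : HeckeRep d) :
    (φ • α).b = ((φ : (Jet d)ˣ) : Jet d) * α.b := rfl

theorem smul_equiv {d : ℕ} (φ : jetGroup d) {α β : HeckeRep d} (h : α ≈ β) :
    φ • α ≈ φ • β := by
  obtain ⟨n, h1, h2, h3, h4⟩ := h
  refine ⟨n, h1.smul _, h2.smul _, ?_, ?_⟩
  · rw [heckeRep_smul_a, heckeRep_smul_a, ← mul_sub, jetGroup_dvd]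
    exact h3
  · rw [heckeRep_smul_b, heckeRep_smul_b, ← mul_sub, jetGroup_dvd]
    exact h4

/-- The induced action of `G_D` on `Heck_d`. -/
instance (d : ℕ) : MulAction (jetGroup d) (Heck d) where
  smul φ := Quotient.map (fun α => φ • α) (fun _ _ h => smul_equiv φ h)
  one_smul h := by
    induction h using Quotient.inductionOn with
    | h α => exact congrArg (Quotient.mk _) (one_smul (jetGroup d) α)
  mul_smul φ ψ h := by
    induction h using Quotient.inductionOn with
    | h α => exact congrArg (Quotient.mk _) (mul_smul φ ψ α)

/-- The quotient `Heck_d / G_D`. -/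
abbrev HeckQuot (d : ℕ) : Type := MulAction.orbitRel.Quotient (jetGroup d) (Heck d)

/-- The class in `Heck_d / G_D` of a representative. -/
def HeckeRep.cls {d : ℕ} (α : HeckeRep d) : HeckQuot d :=
  Quotient.mk _ (Quotient.mk (heckeSetoid d) α)

/-- The representatives of the elements of the stratum `V_n`. -/
def stratum (d n : ℕ) : Set (HeckeRep d) := {α | HasOrd α.a α.b n}

/-! ### Weighted projective spaces -/

/-- Nonzero vectors up to the action `y_j ↦ c ^ (w j) * y_j` of `c ∈ ℂˣ`. -/
def wprojSetoid {m : ℕ} (w : Fin (m + 1) → ℕ) : Setoid {y : Fin (m + 1) → ℂ // y ≠ 0} where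
  r y y' := ∃ c : ℂˣ, ∀ j, y'.1 j = (c : ℂ) ^ w j * y.1 j
  iseqv :=
    { refl := fun y => ⟨1, by simp⟩
      symm := by
        rintro y y' ⟨c, h⟩
        refine ⟨c⁻¹, fun j => ?_⟩
        rw [h j, ← mul_assoc, ← mul_pow, Units.inv_mul, one_pow, one_mul]
      trans := by
        rintro y y' y'' ⟨c, h⟩ ⟨e, h'⟩
        refine ⟨e * c, fun j => ?_⟩
        rw [h' j, h j, Units.val_mul, mul_pow, mul_assoc] }

/-- The weighted projective space `P(w_0, …, w_m)`. -/
def WProj {m : ℕ} (w : Fin (m + 1) → ℕ) : Type := Quotient (wprojSetoid w)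

/-- The point `(y_0 : … : y_m)`. -/
def WProj.mk {m : ℕ} (w : Fin (m + 1) → ℕ) (y : Fin (m + 1) → ℂ) (hy : y ≠ 0) : WProj w :=
  Quotient.mk (wprojSetoid w) ⟨y, hy⟩

/-- The set of homogeneous coordinate vectors of the points of `Y`. -/
def WProj.cone {m : ℕ} {w : Fin (m + 1) → ℕ} (Y : Set (WProj w)) : Set (Fin (m + 1) → ℂ) :=
  {y | ∃ hy : y ≠ 0, WProj.mk w y hy ∈ Y}

/-- A locally closed subvariety of affine space: the common zeros of a set of polynomials, minus
the common zeros of another. -/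
def IsLocallyClosedVar {ι : Type} (S : Set (ι → ℂ)) : Prop :=
  ∃ P Q : Set (MvPolynomial ι ℂ),
    S = {x | (∀ p ∈ P, MvPolynomial.eval x p = 0) ∧ ∃ q ∈ Q, MvPolynomial.eval x q ≠ 0}

/-- A toric subspace of `P(w)`: a locally closed subvariety that is preserved by the torus acting
through coordinatewise scaling, i.e. a locally closed union of torus orbits. -/
structure WProj.IsToric {m : ℕ} {w : Fin (m + 1) → ℕ} (Y : Set (WProj w)) : Prop where
  locallyClosed : IsLocallyClosedVar (WProj.cone Y)
  torus_invariant : ∀ (t : Fin (m + 1) → ℂˣ), ∀ y ∈ WProj.cone Y,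
    (fun j => (t j : ℂ) * y j) ∈ WProj.cone Y

/-- A point of the orbifold `P(w)` is nonsingular if its isotropy group is trivial, i.e. `ℂˣ` acts
freely at its coordinate vectors. For the weights `(1, 1, 2, …, m)` and `(1, …, 1)` no isotropy
group contains a reflection, so these are the nonsingular points of the variety `P(w)` as well. -/
def WProj.IsNonsingular {m : ℕ} {w : Fin (m + 1) → ℕ} (p : WProj w) : Prop :=
  ∀ y ∈ WProj.cone {p}, ∀ c : ℂˣ, (∀ j, (c : ℂ) ^ w j * y j = y j) → c = 1

/-- The weights `(1, 1, 2, 3, …, m)`. -/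
def weights (m : ℕ) : Fin (m + 1) → ℕ := fun j => max 1 (j : ℕ)

/-! ### Pieces of the quotient and their gluing -/

/-- The data of a subset of `Heck_d / G_D`, given by a set of representatives, and of a map from
it to a weighted projective space (values of `map` outside the subset are irrelevant). -/
structure Piece (d : ℕ) where
  reps : Set (HeckeRep d)
  m : ℕ
  weight : Fin (m + 1) → ℕ
  map : HeckQuot d → WProj weight

/-- The subset of `Heck_d` given by the representatives. -/
def Piece.heckSet {d : ℕ} (p : Piece d) : Set (Heck d) :=
  Quotient.mk (heckeSetoid d) '' p.reps

/-- The subset of the quotient `Heck_d / G_D` given by the representatives. -/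
def Piece.carrier {d : ℕ} (p : Piece d) : Set (HeckQuot d) := HeckeRep.cls '' p.reps

/-- The piece is a connected, locally closed, `G_D`-stable family of Hecke parameters, which is
identified modulo `G_D` with a toric subspace of nonsingular points by an algebraic map. -/
structure Piece.IsToricPiece {d : ℕ} (p : Piece d) : Prop where
  stable : ∀ (φ : jetGroup d), ∀ α ∈ p.reps, φ • α ∈ p.reps
  locallyClosed : IsLocallyClosedVar (HeckeRep.coords '' p.reps)
  connected : IsConnected (HeckeRep.coords '' p.reps)
  /-- the map to `P(w)` is given by polynomials in the coefficients of the jets -/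
  algebraic : ∃ F : Fin (p.m + 1) → MvPolynomial (Fin d) ℂ, ∀ α ∈ p.reps,
    ∃ h : (fun j => MvPolynomial.eval α.coords (F j)) ≠ 0, p.map α.cls = WProj.mk p.weight _ h
  /-- the map separates the `G_D`-orbits -/
  separates : Set.InjOn p.map p.carrier
  toric : WProj.IsToric (p.map '' p.carrier)
  nonsingular : ∀ y ∈ p.map '' p.carrier, WProj.IsNonsingular y

/-- The overlap of the pieces `p` and `q` is a toric subspace in the weighted projective space of
`p`, and the coordinate change from `p` to `q` on it is given by polynomials in the homogeneous
coordinates. -/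
structure Piece.GluesTo {d : ℕ} (p q : Piece d) : Prop where
  toric : WProj.IsToric (p.map '' (p.carrier ∩ q.carrier))
  algebraic : ∃ F : Fin (q.m + 1) → MvPolynomial (Fin (p.m + 1)) ℂ,
    ∀ x ∈ p.carrier ∩ q.carrier, ∀ y ∈ WProj.cone {p.map x},
      ∃ h : (fun j => MvPolynomial.eval y (F j)) ≠ 0, q.map x = WProj.mk q.weight _ h

end HeckeModuli

end

/-!
The two entries of a representative `(a, b)` are odd and even, so the representative is the same
as the single jet `a + b = ∑ x_j z ^ j`, on which an element of `G_D` acts as multiplication by a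
unit power series in `w = z ^ 2`. Fix `k` and an index `s` of the other parity, `k + s ≤ d`, and
consider the locus where the entry with the parity of `k` has order exactly `k`, the other one has
order at least `s`, and the order of the pair is at most `d - k`. There one can write the entries
as `z ^ k A(w)` and `z ^ s B(w)` with `A(0) ≠ 0`. The first `m = (d - k - s) / 2` coefficients of
the quotient `B / A` depend only on the class in `Heck_d / G_D` (`chartCoord_eq_of_cls_eq`),
separate the classes (`cls_eq_of_chartCoord_eq`), and take all values
(`exists_chartCoord_eq`). So the quotient of this locus is an affine space `ℂ ^ m`, and it is
placed as the chart `{y_0 ≠ 0}` into a projective space with arbitrary weights `1, w_1, …, w_m`.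

The stratum `V_n` is the case `k = n`, `s = n + 1`. The pieces `N_i` are the cases where `s` is
`0` or `1`, which impose no condition on the second entry except for the bound on the order; they
contain classes of different order. A class of order `l` is connected to lower strata as follows
(`exists_chart_connecting`). If the orders have different parity, take `k = l`. If they have the
same parity, look at the entry whose parity is different from that of `l`. If it is nonzero modulo
`z ^ (d - l)`, take its order as `k`. Otherwise its coefficient of index `d - l` does not matter for
the class and may be chosen to be `1`, and `k = d - l` works.

Two charts with distinguished orders `k ≠ k'` of the same parity are disjoint, and if `k = k'` the
coordinate change is a shift of the coordinates (`overlap_same`). If the parities are different, a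
common class has `B = w ^ t q` with `q` invertible (or `B` vanishing to the precision in question),
and the coordinate change replaces `q / A` by `A / q` (`overlap_opposite`). Hence the overlap is
defined by the vanishing of some coordinates and possibly the nonvanishing of one further
coordinate, which is the only denominator of the coordinate change; homogeneous polynomials are
obtained by clearing denominators (`IsRegular.exists_polynomial`).
-/

noncomputable section

namespace HeckeModuli

/-! ### Coefficients of jets -/

/-- The `i`-th Taylor coefficient of a jet, for all natural numbers `i`; it is `0` for `d ≤ i`. -/
def jc {d : ℕ} (f : Jet d) (i : ℕ) : ℂ :=
  (AdjoinRoot.modByMonicHom (monic_X_pow d) f).coeff i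

theorem jc_mk {d : ℕ} (p : ℂ[X]) (i : ℕ) :
    jc (AdjoinRoot.mk (X ^ d) p : Jet d) i = if i < d then p.coeff i else 0 := by
  rw [jc, AdjoinRoot.modByMonicHom_mk]
  split_ifs with h
  · rw [modByMonic_eq_sub_mul_div, coeff_sub, coeff_X_pow_mul', if_neg (by omega), sub_zero]
  · apply coeff_eq_zero_of_degree_lt
    refine (degree_modByMonic_lt p (monic_X_pow d)).trans_le ?_
    rw [degree_X_pow]
    exact_mod_cast not_lt.1 h

theorem jc_of_le {d : ℕ} (f : Jet d) {i : ℕ} (h : d ≤ i) : jc f i = 0 := by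
  obtain ⟨p, rfl⟩ := AdjoinRoot.mk_surjective f
  rw [jc_mk, if_neg (by omega)]

theorem zz_pow_dvd_iff {d : ℕ} (n : ℕ) (f : Jet d) : zz d ^ n ∣ f ↔ ∀ i < n, jc f i = 0 := by
  obtain ⟨p, rfl⟩ := AdjoinRoot.mk_surjective f
  have hz : zz d ^ n = AdjoinRoot.mk (X ^ d) (X ^ n) := by rw [map_pow, AdjoinRoot.mk_X, zz]
  rw [hz]
  constructor
  · rintro ⟨g, hg⟩ i hi
    obtain ⟨q, rfl⟩ := AdjoinRoot.mk_surjective g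
    rw [hg, ← map_mul, jc_mk, coeff_X_pow_mul', if_neg (not_le.2 hi), ite_self]
  · intro h
    rcases le_total n d with hn | hn
    · apply _root_.map_dvd
      rw [X_pow_dvd_iff]
      intro i hi
      simpa [jc_mk, hi.trans_le hn] using h i hi
    · have : AdjoinRoot.mk (X ^ d) p = 0 := by
        rw [AdjoinRoot.mk_eq_zero, X_pow_dvd_iff]
        intro i hi
        simpa [jc_mk, hi] using h i (hi.trans_le hn)
      rw [this]
      exact dvd_zero _

theorem jc_sub {d : ℕ} (f g : Jet d) (i : ℕ) : jc (f - g) i = jc f i - jc g i := by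
  rw [jc, map_sub, coeff_sub, jc, jc]

theorem jc_add {d : ℕ} (f g : Jet d) (i : ℕ) : jc (f + g) i = jc f i + jc g i := by
  rw [jc, map_add, coeff_add, jc, jc]

theorem jc_neg {d : ℕ} (f : Jet d) (i : ℕ) : jc (-f) i = -jc f i := by
  rw [jc, map_neg, coeff_neg, jc]

theorem jet_ext {d : ℕ} {f g : Jet d} (h : ∀ i < d, jc f i = jc g i) : f = g := by
  have : zz d ^ d ∣ f - g := (zz_pow_dvd_iff d _).2 fun i hi => by rw [jc_sub, h i hi, sub_self]
  rw [zz_pow, zero_dvd_iff, sub_eq_zero] at this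
  exact this

theorem jc_mul {d : ℕ} (f g : Jet d) {i : ℕ} (hi : i < d) :
    jc (f * g) i = ∑ p ∈ Finset.HasAntidiagonal.antidiagonal i, jc f p.1 * jc g p.2 := by
  obtain ⟨p, rfl⟩ := AdjoinRoot.mk_surjective f
  obtain ⟨q, rfl⟩ := AdjoinRoot.mk_surjective g
  rw [← map_mul, jc_mk, if_pos hi, coeff_mul]
  refine Finset.sum_congr rfl fun x hx => ?_
  rw [Finset.HasAntidiagonal.mem_antidiagonal] at hx
  rw [jc_mk, jc_mk, if_pos (by omega), if_pos (by omega)]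

theorem jc_sigma {d : ℕ} (f : Jet d) (i : ℕ) : jc (sigma d f) i = (-1) ^ i * jc f i := by
  obtain ⟨p, rfl⟩ := AdjoinRoot.mk_surjective f
  have : sigma d (AdjoinRoot.mk (X ^ d) p) = AdjoinRoot.mk (X ^ d) (p.comp (-X)) := by
    have e : (sigma d).comp (AdjoinRoot.mkₐ (X ^ d)) =
        (AdjoinRoot.mkₐ (X ^ d)).comp (Polynomial.aeval (-X : ℂ[X])) := by
      apply Polynomial.algHom_ext
      simp [sigma, zz]
    have := DFunLike.congr_fun e p
    simpa [Polynomial.aeval_def, Polynomial.comp, Polynomial.algebraMap_eq] using this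
  rw [this, jc_mk, jc_mk, show (-X : ℂ[X]) = C (-1) * X by simp, comp_C_mul_X_coeff]
  split_ifs
  · ring
  · simp

/-- The jet with prescribed Taylor coefficients. -/
def jetOf (d : ℕ) (x : ℕ → ℂ) : Jet d :=
  AdjoinRoot.mk (X ^ d) (PowerSeries.trunc d (PowerSeries.mk x))

theorem jc_jetOf {d : ℕ} (x : ℕ → ℂ) {i : ℕ} (hi : i < d) : jc (jetOf d x) i = x i := by
  rw [jetOf, jc_mk, if_pos hi, PowerSeries.coeff_trunc, if_pos hi, PowerSeries.coeff_mk]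

theorem isUnit_jet {d : ℕ} {f : Jet d} (h : jc f 0 ≠ 0) : IsUnit f := by
  have hc : PowerSeries.constantCoeff (PowerSeries.mk (jc f)) ≠ 0 := by
    rwa [← PowerSeries.coeff_zero_eq_constantCoeff_apply, PowerSeries.coeff_mk]
  refine IsUnit.of_mul_eq_one (jetOf d fun i => PowerSeries.coeff i (PowerSeries.mk (jc f))⁻¹)
    (jet_ext fun i hi => ?_)
  have h1 := congrArg (PowerSeries.coeff i) (PowerSeries.mul_inv_cancel _ hc)
  rw [PowerSeries.coeff_mul, PowerSeries.coeff_one] at h1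
  have h2 : jc (1 : Jet d) i = if i = 0 then 1 else 0 := by
    rw [← map_one (AdjoinRoot.mk (X ^ d)), jc_mk, if_pos hi, coeff_one]
  rw [jc_mul _ _ hi, h2, ← h1]
  refine Finset.sum_congr rfl fun p hp => ?_
  rw [Finset.HasAntidiagonal.mem_antidiagonal] at hp
  rw [jc_jetOf _ (by omega), PowerSeries.coeff_mk]

/-! ### Coefficients of Hecke parameters -/

/-- The coefficient `x_j` of a representative, for all natural numbers `j`: the `j`-th Taylor
coefficient of the single jet `a + b`. -/
def HeckeRep.x {d : ℕ} (α : HeckeRep d) (j : ℕ) : ℂ := jc (α.a + α.b) j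

theorem HeckeRep.jc_a {d : ℕ} (α : HeckeRep d) (j : ℕ) :
    jc α.a j = if Odd j then α.x j else 0 := by
  have h1 := congrArg (fun f => jc f j) α.odd_a
  have h2 := congrArg (fun f => jc f j) α.even_b
  simp only [jc_sigma, jc_neg] at h1 h2
  rw [HeckeRep.x, jc_add]
  split_ifs with h
  · rw [h.neg_one_pow] at h2
    linear_combination (1 / 2 : ℂ) * h2
  · rw [(Nat.not_odd_iff_even.1 h).neg_one_pow] at h1
    linear_combination (1 / 2 : ℂ) * h1

theorem HeckeRep.jc_b {d : ℕ} (α : HeckeRep d) (j : ℕ) :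
    jc α.b j = if Odd j then 0 else α.x j := by
  have h1 := α.jc_a j
  have h2 : α.x j = jc α.a j + jc α.b j := jc_add _ _ _
  split_ifs at h1 ⊢ <;> rw [h1] at h2 <;> linear_combination -h2

theorem HeckeRep.coords_apply {d : ℕ} (α : HeckeRep d) (i : Fin d) : α.coords i = α.x i := by
  have h : ∀ f : Jet d, jetCoeff i f = jc f i := fun f => rfl
  rw [HeckeRep.coords]
  split_ifs with h1
  · rw [h, α.jc_a, if_pos h1]
  · rw [h, α.jc_b, if_neg h1]

theorem HeckeRep.x_of_le {d : ℕ} (α : HeckeRep d) {j : ℕ} (h : d ≤ j) : α.x j = 0 := jc_of_le _ h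

/-- Divisibility of both entries by `z ^ n` only depends on the sum of the two entries. -/
theorem zz_pow_dvd_and_iff {d : ℕ} (n : ℕ) {f g : Jet d} {x : ℕ → ℂ}
    (hf : ∀ j, jc f j = if Odd j then x j else 0) (hg : ∀ j, jc g j = if Odd j then 0 else x j) :
    zz d ^ n ∣ f ∧ zz d ^ n ∣ g ↔ ∀ j < n, x j = 0 := by
  rw [zz_pow_dvd_iff, zz_pow_dvd_iff, ← forall₂_and]
  refine forall₂_congr fun j _ => ?_
  rw [hf, hg]
  split_ifs <;> simp

theorem HeckeRep.hasOrd_iff {d : ℕ} (α : HeckeRep d) (n : ℕ) :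
    HasOrd α.a α.b n ↔ (∀ j < n, α.x j = 0) ∧ α.x n ≠ 0 := by
  rw [HasOrd, zz_pow_dvd_and_iff n α.jc_a α.jc_b, zz_pow_dvd_and_iff (n + 1) α.jc_a α.jc_b]
  constructor
  · rintro ⟨h1, h2⟩
    refine ⟨h1, fun h => h2 fun j hj => ?_⟩
    rcases Nat.lt_succ_iff_lt_or_eq.1 hj with h' | rfl
    exacts [h1 j h', h]
  · rintro ⟨h1, h2⟩
    exact ⟨h1, fun h => h2 (h n n.lt_succ_self)⟩

theorem HeckeRep.equiv_iff {d : ℕ} (α β : HeckeRep d) :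
    α ≈ β ↔ ∃ n, HasOrd α.a α.b n ∧ HasOrd β.a β.b n ∧ ∀ j < d - n, α.x j = β.x j := by
  have h : ∀ n, (zz d ^ (d - n) ∣ α.a - β.a ∧ zz d ^ (d - n) ∣ α.b - β.b) ↔
      ∀ j < d - n, α.x j = β.x j := by
    intro n
    rw [zz_pow_dvd_and_iff (d - n) (x := fun j => α.x j - β.x j)]
    · simp only [sub_eq_zero]
    · intro j
      rw [jc_sub, α.jc_a, β.jc_a]
      split_ifs <;> simp
    · intro j
      rw [jc_sub, α.jc_b, β.jc_b]
      split_ifs <;> simp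
  exact exists_congr fun n => and_congr_right fun _ => and_congr_right fun _ => h n

/-- Every coefficient vector of order less than `d / 2` comes from a representative. -/
theorem HeckeRep.exists_x_eq {d : ℕ} (x : ℕ → ℂ) {n : ℕ} (hn : 2 * n < d) (hx : x n ≠ 0) :
    ∃ α : HeckeRep d, ∀ j < d, α.x j = x j := by
  have ha : ∀ j, jc (jetOf d fun j => if Odd j then x j else 0) j =
      if Odd j then (if j < d then x j else 0) else 0 := by
    intro j
    by_cases hj : j < d
    · simp [jc_jetOf _ hj, hj]
    · simp [jc_of_le _ (not_lt.1 hj), hj]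
  have hb : ∀ j, jc (jetOf d fun j => if Odd j then 0 else x j) j =
      if Odd j then 0 else (if j < d then x j else 0) := by
    intro j
    by_cases hj : j < d
    · simp [jc_jetOf _ hj, hj]
    · simp [jc_of_le _ (not_lt.1 hj), hj]
  refine ⟨⟨jetOf d fun j => if Odd j then x j else 0, jetOf d fun j => if Odd j then 0 else x j,
    jet_ext fun j hj => ?_, jet_ext fun j hj => ?_, ?_⟩, fun j hj => ?_⟩
  · rw [jc_sigma, jc_neg, ha]
    split_ifs with h <;> simp [h]
  · rw [jc_sigma, hb]
    split_ifs with h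
    · simp
    · simp [(Nat.not_odd_iff_even.1 h).neg_one_pow]
  · classical
    have hex : ∃ n, x n ≠ 0 := ⟨n, hx⟩
    have hle : Nat.find hex ≤ n := Nat.find_min' hex hx
    refine ⟨Nat.find hex, by omega, ?_⟩
    rw [HasOrd, zz_pow_dvd_and_iff _ ha hb, zz_pow_dvd_and_iff _ ha hb]
    constructor
    · intro j hj
      have := not_not.1 (Nat.find_min hex hj)
      simp [this]
    · intro h
      have := h _ (Nat.lt_succ_self _)
      rw [if_pos (by omega)] at this
      exact Nat.find_spec hex this
  · rw [HeckeRep.x, jc_add, ha, hb, if_pos hj]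
    split_ifs <;> simp

/-- A sum over `antidiagonal j` in which only even first entries contribute. -/
theorem sum_antidiagonal_even (u y : ℕ → ℂ) (hu : ∀ i, Odd i → u i = 0) (j : ℕ) :
    ∑ p ∈ Finset.HasAntidiagonal.antidiagonal j, u p.1 * y p.2 =
      ∑ i ∈ Finset.range (j / 2 + 1), u (2 * i) * y (j - 2 * i) := by
  symm
  rw [Finset.Nat.sum_antidiagonal_eq_sum_range_succ (fun p q => u p * y q)]
  refine Finset.sum_of_injOn (fun i => 2 * i) (fun a _ b _ h => by simpa using h) ?_ ?_ ?_
  · intro i hi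
    simp only [Finset.coe_range, Set.mem_Iio] at hi ⊢
    omega
  · intro i hi hi'
    rw [hu i, zero_mul]
    by_contra h
    obtain ⟨t, rfl⟩ := even_iff_two_dvd.1 (Nat.not_odd_iff_even.1 h)
    simp only [Finset.mem_range] at hi
    exact hi' ⟨t, by simp only [Finset.coe_range, Set.mem_Iio]; omega, rfl⟩
  · intro i _
    rfl

theorem HeckeRep.x_smul {d : ℕ} (φ : jetGroup d) (α : HeckeRep d) {j : ℕ} (hj : j < d) :
    (φ • α).x j = ∑ i ∈ Finset.range (j / 2 + 1),
      jc ((φ : (Jet d)ˣ) : Jet d) (2 * i) * α.x (j - 2 * i) := by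
  rw [HeckeRep.x, heckeRep_smul_a, heckeRep_smul_b, ← mul_add, jc_mul _ _ hj]
  refine sum_antidiagonal_even _ α.x (fun i hi => ?_) j
  have hφ : sigma d ((φ : (Jet d)ˣ) : Jet d) = ((φ : (Jet d)ˣ) : Jet d) := φ.2
  have h1 := congrArg (fun f => jc f i) hφ
  simp only [jc_sigma, hi.neg_one_pow] at h1
  linear_combination (-1 / 2 : ℂ) * h1

theorem jetGroup_jc_zero {d : ℕ} (hd : 0 < d) (φ : jetGroup d) :
    jc ((φ : (Jet d)ˣ) : Jet d) 0 ≠ 0 := by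
  intro h
  have h1 : jc (((φ : (Jet d)ˣ) : Jet d) * (((φ : (Jet d)ˣ)⁻¹ : (Jet d)ˣ) : Jet d)) 0 = 0 := by
    rw [jc_mul _ _ hd]
    simp [h]
  rw [Units.mul_inv, ← map_one (AdjoinRoot.mk (X ^ d)), jc_mk, if_pos hd] at h1
  simp at h1

/-- Power series in `w = z ^ 2` with nonzero constant term are realized by elements of `G_D`. -/
theorem exists_jetGroup {d : ℕ} (hd : 0 < d) (φ : PowerSeries ℂ)
    (hφ : PowerSeries.coeff 0 φ ≠ 0) :
    ∃ ψ : jetGroup d, ∀ i, 2 * i < d →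
      jc ((ψ : (Jet d)ˣ) : Jet d) (2 * i) = PowerSeries.coeff i φ := by
  set f := jetOf d fun j => if Odd j then 0 else PowerSeries.coeff (j / 2) φ with hf
  have hu : IsUnit f := isUnit_jet (by rw [hf, jc_jetOf _ hd]; simpa using hφ)
  refine ⟨⟨hu.unit, jet_ext fun j hj => ?_⟩, fun i hi => ?_⟩
  · rw [jc_sigma, IsUnit.unit_spec, hf, jc_jetOf _ hj]
    split_ifs with h
    · simp
    · simp [(Nat.not_odd_iff_even.1 h).neg_one_pow]
  · change jc f (2 * i) = _
    rw [hf, jc_jetOf _ hi]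
    simp

/-- Classes in `Heck_d / G_D` coincide if and only if the coefficients agree up to the action of
`G_D` and the equivalence of representatives. -/
theorem HeckeRep.cls_eq_iff {d : ℕ} (α β : HeckeRep d) :
    α.cls = β.cls ↔ ∃ φ : jetGroup d, φ • α ≈ β := by
  rw [HeckeRep.cls, HeckeRep.cls, eq_comm, Quotient.eq]
  change (Quotient.mk _ β : Heck d) ∈ MulAction.orbit (jetGroup d) (Quotient.mk _ α : Heck d) ↔ _
  refine exists_congr fun φ => ?_
  change (Quotient.mk (heckeSetoid d) (φ • α)) = Quotient.mk _ β ↔ _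
  exact Quotient.eq

/-! ### Charts of the space of Hecke parameters -/

/-- The series `∑ x_{k + 2 i} w ^ i` in `w = z ^ 2` of the coefficients of one parity. -/
def ser (x : ℕ → ℂ) (k : ℕ) : PowerSeries ℂ := PowerSeries.mk fun i => x (k + 2 * i)

@[simp] theorem coeff_ser (x : ℕ → ℂ) (k i : ℕ) :
    PowerSeries.coeff i (ser x k) = x (k + 2 * i) := PowerSeries.coeff_mk _ _

@[simp] theorem constantCoeff_ser (x : ℕ → ℂ) (k : ℕ) :
    PowerSeries.constantCoeff (ser x k) = x k := by
  rw [← PowerSeries.coeff_zero_eq_constantCoeff_apply, coeff_ser, mul_zero, add_zero]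

theorem ser_eq_X_pow_mul {x : ℕ → ℂ} {s r : ℕ} (hsr : s ≤ r) (hp : r % 2 = s % 2)
    (h : ∀ j < r, j % 2 = s % 2 → x j = 0) :
    ser x s = PowerSeries.X ^ ((r - s) / 2) * ser x r := by
  ext i
  rw [PowerSeries.coeff_X_pow_mul', coeff_ser]
  split_ifs with hi
  · rw [coeff_ser]
    congr 1
    omega
  · exact h _ (by omega) (by omega)

theorem powerSeries_dvd_sub_iff {m : ℕ} {f g : PowerSeries ℂ} :
    PowerSeries.X ^ m ∣ f - g ↔ ∀ i < m, PowerSeries.coeff i f = PowerSeries.coeff i g := by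
  rw [PowerSeries.X_pow_dvd_iff]
  simp only [map_sub, sub_eq_zero]

/-- How the truncation of a quotient of power series depends on the truncations of numerator and
denominator, if the numerator is divisible by `w ^ t`. -/
theorem dvd_quot_sub {m t p : ℕ} {A A' B B' : PowerSeries ℂ}
    (hA : PowerSeries.constantCoeff A ≠ 0) (hA' : PowerSeries.constantCoeff A' ≠ 0)
    (hB : PowerSeries.X ^ t ∣ B) (h1 : PowerSeries.X ^ p ∣ A - A')
    (h2 : PowerSeries.X ^ m ∣ B - B') (hm : m ≤ t + p) :
    PowerSeries.X ^ m ∣ B * A⁻¹ - B' * A'⁻¹ := by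
  have e : B * A⁻¹ - B' * A'⁻¹ = (A⁻¹ * A'⁻¹) * (A * (B - B') - B * (A - A')) := by
    linear_combination (-B * A⁻¹) * PowerSeries.mul_inv_cancel A' hA'
      + (B' * A'⁻¹) * PowerSeries.mul_inv_cancel A hA
  rw [e]
  refine Dvd.dvd.mul_left (dvd_sub (Dvd.dvd.mul_left h2 _) ?_) _
  refine (pow_dvd_pow _ hm).trans ?_
  rw [pow_add]
  exact mul_dvd_mul hB h1

/-- The parameters `k < d` and `s` define a chart of the space of Hecke parameters, where `d` is
odd: they have different parity and `k + s ≤ d`. -/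
structure IsChart (d k s : ℕ) : Prop where
  odd : d % 2 = 1
  parity : (k + s) % 2 = 1
  lt : k < d
  le : k + s ≤ d

/-- The representatives of the points of a chart: among the entries `a`, `b`, the one with the
parity of `k` has order exactly `k`, the other one has order at least `s`, and at least one of them
has order at most `d - k`. -/
def chartReps (d k s : ℕ) : Set (HeckeRep d) :=
  {α | (∀ j < k, j % 2 = k % 2 → α.x j = 0) ∧ α.x k ≠ 0 ∧
    (∀ j < s, j % 2 = s % 2 → α.x j = 0) ∧ ∃ j ≤ d - k, α.x j ≠ 0}

/-- The affine coordinates of a point of a chart: the coefficients of the quotient of the two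
entries of a representative, both divided by suitable powers of `z`. Only the coordinates with
`i < (d - k - s) / 2` are invariant under the equivalence of representatives. -/
def chartCoord (k s : ℕ) (x : ℕ → ℂ) (i : ℕ) : ℂ :=
  PowerSeries.coeff i (ser x s * (ser x k)⁻¹)

theorem exists_ord_of_mem {d k s : ℕ} {α : HeckeRep d} (h : α ∈ chartReps d k s) :
    ∃ n, HasOrd α.a α.b n ∧ n ≤ k ∧ n ≤ d - k ∧ 2 * n < d := by
  obtain ⟨n, hn, ho⟩ := α.ord_lt
  obtain ⟨-, h2, -, j, hj, hj'⟩ := h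
  have ho' := (α.hasOrd_iff n).1 ho
  refine ⟨n, ho, ?_, ?_, hn⟩
  · by_contra hc
    exact h2 (ho'.1 k (by omega))
  · by_contra hc
    exact hj' (ho'.1 j (by omega))

theorem coeff_ser_smul {d : ℕ} (φ : jetGroup d) (α : HeckeRep d) {k i : ℕ} (hi : k + 2 * i < d)
    (h : ∀ j < k, j % 2 = k % 2 → α.x j = 0) :
    PowerSeries.coeff i (ser (φ • α).x k) =
      PowerSeries.coeff i (ser (jc ((φ : (Jet d)ˣ) : Jet d)) 0 * ser α.x k) := by
  rw [coeff_ser, α.x_smul φ hi, PowerSeries.coeff_mul,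
    Finset.Nat.sum_antidiagonal_eq_sum_range_succ
      (fun p q => PowerSeries.coeff p (ser (jc ((φ : (Jet d)ˣ) : Jet d)) 0) *
        PowerSeries.coeff q (ser α.x k))]
  symm
  refine Finset.sum_subset_zero_on_sdiff ?_ ?_ ?_
  · intro j hj
    rw [Finset.mem_range] at hj ⊢
    omega
  · intro j hj
    rw [Finset.mem_sdiff, Finset.mem_range, Finset.mem_range] at hj
    rw [h _ (by omega) (by omega), mul_zero]
  · intro j hj
    rw [Finset.mem_range] at hj
    rw [coeff_ser, coeff_ser, zero_add, show k + 2 * (i - j) = k + 2 * i - 2 * j by omega]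

theorem x_smul_eq_zero {d k : ℕ} (φ : jetGroup d) (α : HeckeRep d)
    (h : ∀ j < k, j % 2 = k % 2 → α.x j = 0) : ∀ j < k, j % 2 = k % 2 → (φ • α).x j = 0 := by
  intro j hj hp
  by_cases hjd : j < d
  · rw [α.x_smul φ hjd]
    refine Finset.sum_eq_zero fun i hi => ?_
    rw [Finset.mem_range] at hi
    rw [h _ (by omega) (by omega), mul_zero]
  · exact (φ • α).x_of_le (not_lt.1 hjd)

theorem x_smul_ne_zero {d k : ℕ} (φ : jetGroup d) (α : HeckeRep d) (hkd : k < d)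
    (h : ∀ j < k, j % 2 = k % 2 → α.x j = 0) (hk : α.x k ≠ 0) : (φ • α).x k ≠ 0 := by
  have h1 := coeff_ser_smul φ α (k := k) (i := 0) (by omega) h
  rw [coeff_ser, PowerSeries.coeff_zero_eq_constantCoeff_apply, map_mul, constantCoeff_ser,
    constantCoeff_ser, mul_zero, add_zero] at h1
  rw [h1]
  exact mul_ne_zero (jetGroup_jc_zero (by omega) φ) hk

theorem smul_mem_chartReps {d k s : ℕ} (hc : IsChart d k s) (φ : jetGroup d) {α : HeckeRep d}
    (h : α ∈ chartReps d k s) : φ • α ∈ chartReps d k s := by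
  obtain ⟨n, ho, -, hn, -⟩ := exists_ord_of_mem h
  obtain ⟨h1, h2, h3, -⟩ := h
  refine ⟨x_smul_eq_zero φ α h1, x_smul_ne_zero φ α hc.lt h1 h2, x_smul_eq_zero φ α h3, n, hn, ?_⟩
  have := HasOrd.smul ho (φ : (Jet d)ˣ)
  rw [← heckeRep_smul_a, ← heckeRep_smul_b, HeckeRep.hasOrd_iff] at this
  exact this.2

theorem constantCoeff_ser_jetGroup {d : ℕ} (hd : 0 < d) (φ : jetGroup d) :
    PowerSeries.constantCoeff (ser (jc ((φ : (Jet d)ˣ) : Jet d)) 0) ≠ 0 := by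
  rw [constantCoeff_ser]
  exact jetGroup_jc_zero hd φ

theorem chartCoord_smul {d k s : ℕ} (hc : IsChart d k s) (φ : jetGroup d) {α : HeckeRep d}
    (h : α ∈ chartReps d k s) {i : ℕ} (hi : i < (d - k - s) / 2) :
    chartCoord k s (φ • α).x i = chartCoord k s α.x i := by
  have := hc.lt
  have hU := constantCoeff_ser_jetGroup (by omega) φ
  set U := ser (jc ((φ : (Jet d)ˣ) : Jet d)) 0
  have hA : PowerSeries.constantCoeff (ser α.x k) ≠ 0 := by rw [constantCoeff_ser]; exact h.2.1
  have hA' : PowerSeries.constantCoeff (ser (φ • α).x k) ≠ 0 := by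
    rw [constantCoeff_ser]
    exact (smul_mem_chartReps hc φ h).2.1
  have hUA : PowerSeries.constantCoeff (U * ser α.x k) ≠ 0 := by
    rw [map_mul]; exact mul_ne_zero hU hA
  have key : PowerSeries.X ^ ((d - k - s) / 2) ∣
      ser (φ • α).x s * (ser (φ • α).x k)⁻¹ - (U * ser α.x s) * (U * ser α.x k)⁻¹ := by
    refine dvd_quot_sub (t := 0) (p := (d - k - s) / 2) hA' hUA (by simp) ?_ ?_ (by omega)
    · exact powerSeries_dvd_sub_iff.2 fun i hi => coeff_ser_smul φ α (by omega) h.1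
    · exact powerSeries_dvd_sub_iff.2 fun i hi => coeff_ser_smul φ α (by omega) h.2.2.1
  rw [chartCoord, powerSeries_dvd_sub_iff.1 key i hi, chartCoord, PowerSeries.mul_inv_rev]
  congr 1
  linear_combination (ser α.x s * (ser α.x k)⁻¹) * PowerSeries.mul_inv_cancel U hU

/-- The coordinates of a chart are invariants of the classes in `Heck_d / G_D`. -/
theorem chartCoord_eq_of_cls_eq {d k s : ℕ} (hc : IsChart d k s) {α β : HeckeRep d}
    (hα : α ∈ chartReps d k s) (hβ : β ∈ chartReps d k s) (h : α.cls = β.cls)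
    {i : ℕ} (hi : i < (d - k - s) / 2) : chartCoord k s α.x i = chartCoord k s β.x i := by
  obtain ⟨φ, hφ⟩ := (α.cls_eq_iff β).1 h
  rw [← chartCoord_smul hc φ hα hi]
  have hα' := smul_mem_chartReps hc φ hα
  generalize φ • α = γ at hφ hα'
  obtain ⟨n, h1, h2, h3⟩ := (γ.equiv_iff β).1 hφ
  obtain ⟨n', h1', hk, hdk, -⟩ := exists_ord_of_mem hα'
  obtain rfl := h1.unique h1'
  rw [HeckeRep.hasOrd_iff] at h1
  have := hc.parity
  have := hc.odd
  have := hc.le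
  have key : PowerSeries.X ^ ((d - k - s) / 2) ∣
      ser γ.x s * (ser γ.x k)⁻¹ - ser β.x s * (ser β.x k)⁻¹ := by
    refine dvd_quot_sub (t := (n + 1 - s) / 2) (p := (d - n - k + 1) / 2)
      (by rw [constantCoeff_ser]; exact hα'.2.1) (by rw [constantCoeff_ser]; exact hβ.2.1)
      ?_ ?_ ?_ (by omega)
    · rw [PowerSeries.X_pow_dvd_iff]
      intro i hi
      rw [coeff_ser]
      exact h1.1 _ (by omega)
    · refine powerSeries_dvd_sub_iff.2 fun i hi => ?_
      rw [coeff_ser, coeff_ser]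
      exact h3 _ (by omega)
    · refine powerSeries_dvd_sub_iff.2 fun i hi => ?_
      rw [coeff_ser, coeff_ser]
      exact h3 _ (by omega)
  exact powerSeries_dvd_sub_iff.1 key i hi

/-- The vanishing of the coordinates detects the order of the numerator. -/
theorem chartCoord_eq_zero_iff {k s t : ℕ} {x : ℕ → ℂ} (hx : x k ≠ 0) :
    (∀ i < t, chartCoord k s x i = 0) ↔ ∀ i < t, x (s + 2 * i) = 0 := by
  have hA : PowerSeries.constantCoeff (ser x k) ≠ 0 := by rwa [constantCoeff_ser]
  have h1 : (∀ i < t, chartCoord k s x i = 0) ↔ PowerSeries.X ^ t ∣ ser x s * (ser x k)⁻¹ :=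
    PowerSeries.X_pow_dvd_iff.symm
  have h2 : (∀ i < t, x (s + 2 * i) = 0) ↔ PowerSeries.X ^ t ∣ ser x s := by
    rw [PowerSeries.X_pow_dvd_iff]
    simp only [coeff_ser]
  rw [h1, h2]
  refine ⟨fun h => ?_, fun h => Dvd.dvd.mul_right h _⟩
  have := Dvd.dvd.mul_right h (ser x k)
  rwa [mul_assoc, PowerSeries.inv_mul_cancel _ hA, mul_one] at this

/-- Points of a chart with the same coordinates have the same order. -/
theorem x_eq_zero_of_chartCoord_eq {d k s n : ℕ} (hc : IsChart d k s) {α β : HeckeRep d}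
    (hα : α ∈ chartReps d k s) (hβ : β ∈ chartReps d k s)
    (h : ∀ i < (d - k - s) / 2, chartCoord k s α.x i = chartCoord k s β.x i)
    (hnk : n ≤ k) (hnd : n ≤ d - k) (hn : ∀ j < n, α.x j = 0) : ∀ j < n, β.x j = 0 := by
  intro j hj
  have := hc.parity
  have := hc.odd
  have := hc.le
  by_cases hp : j % 2 = k % 2
  · exact hβ.1 j (by omega) hp
  · by_cases hs : j < s
    · exact hβ.2.2.1 j hs (by omega)
    · have h1 : ∀ i < (j - s) / 2 + 1, chartCoord k s α.x i = 0 :=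
        (chartCoord_eq_zero_iff hα.2.1).2 fun i hi => hn _ (by omega)
      have h2 := (chartCoord_eq_zero_iff (s := s) hβ.2.1).1
        (fun i hi => (h i (by omega)).symm.trans (h1 i hi)) ((j - s) / 2) (by omega)
      rwa [show s + 2 * ((j - s) / 2) = j by omega] at h2

theorem coeff_mul_eq_of_dvd_sub {m i : ℕ} {f g h : PowerSeries ℂ} (hd : PowerSeries.X ^ m ∣ f - g)
    (hi : i < m) : PowerSeries.coeff i (f * h) = PowerSeries.coeff i (g * h) := by
  have h1 : PowerSeries.X ^ m ∣ f * h - g * h := by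
    rw [← sub_mul]
    exact Dvd.dvd.mul_right hd _
  exact powerSeries_dvd_sub_iff.1 h1 i hi

/-- The coordinates of a chart separate the classes in `Heck_d / G_D`. The element of `G_D` that
relates two representatives is the quotient of those of their entries that determine the order. -/
theorem cls_eq_of_chartCoord_eq {d k s : ℕ} (hc : IsChart d k s) {α β : HeckeRep d}
    (hα : α ∈ chartReps d k s) (hβ : β ∈ chartReps d k s)
    (h : ∀ i < (d - k - s) / 2, chartCoord k s α.x i = chartCoord k s β.x i) :
    α.cls = β.cls := by
  obtain ⟨n, hoα, hk, hdk, hn⟩ := exists_ord_of_mem hα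
  obtain ⟨n', hoβ, hk', hdk', hn'⟩ := exists_ord_of_mem hβ
  have hnn : n = n' := by
    rw [HeckeRep.hasOrd_iff] at hoα hoβ
    rcases lt_trichotomy n n' with hlt | heq | hgt
    · exact absurd (x_eq_zero_of_chartCoord_eq hc hβ hα (fun i hi => (h i hi).symm) hk' hdk'
        hoβ.1 n hlt) hoα.2
    · exact heq
    · exact absurd (x_eq_zero_of_chartCoord_eq hc hα hβ h hk hdk hoα.1 n' hgt) hoβ.2
  subst hnn
  have := hc.parity
  have := hc.odd
  have := hc.le
  have hxα := (α.hasOrd_iff n).1 hoα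
  have hxβ := (β.hasOrd_iff n).1 hoβ
  rw [HeckeRep.cls_eq_iff]
  have hA : PowerSeries.constantCoeff (ser α.x k) ≠ 0 := by rw [constantCoeff_ser]; exact hα.2.1
  have hA' : PowerSeries.constantCoeff (ser β.x k) ≠ 0 := by rw [constantCoeff_ser]; exact hβ.2.1
  set A := ser α.x k with hAdef
  set A' := ser β.x k with hAdef'
  have hquot : PowerSeries.X ^ ((d - k - s) / 2) ∣ ser α.x s * A⁻¹ - ser β.x s * A'⁻¹ :=
    powerSeries_dvd_sub_iff.2 h
  -- it suffices to find a series that multiplies the coefficients of `α` to those of `β`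
  suffices hφ : ∃ φ : PowerSeries ℂ, PowerSeries.coeff 0 φ ≠ 0 ∧
      (∀ i, k + 2 * i < d - n → PowerSeries.coeff i (φ * A) = β.x (k + 2 * i)) ∧
      ∀ i, s + 2 * i < d - n → PowerSeries.coeff i (φ * ser α.x s) = β.x (s + 2 * i) by
    obtain ⟨φ, hφ0, h1, h2⟩ := hφ
    obtain ⟨ψ, hψ⟩ := exists_jetGroup (Nat.zero_lt_of_lt hc.lt) φ hφ0
    refine ⟨ψ, (HeckeRep.equiv_iff _ _).2 ⟨n, hoα.smul _, hoβ, fun j hj => ?_⟩⟩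
    have hψ' : ∀ {f : PowerSeries ℂ} {i : ℕ}, 2 * i < d →
        PowerSeries.coeff i (ser (jc ((ψ : (Jet d)ˣ) : Jet d)) 0 * f) =
          PowerSeries.coeff i (φ * f) := by
      intro f i hi
      refine coeff_mul_eq_of_dvd_sub (m := i + 1)
        (powerSeries_dvd_sub_iff.2 fun l hl => ?_) (Nat.lt_succ_self i)
      rw [coeff_ser, zero_add, hψ l (by omega)]
    have hγ := smul_mem_chartReps hc ψ hα
    by_cases hp : j % 2 = k % 2
    · by_cases hjk : j < k
      · rw [hγ.1 j hjk hp, hβ.1 j hjk hp]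
      · have e : j = k + 2 * ((j - k) / 2) := by omega
        have h3 := coeff_ser_smul ψ α (k := k) (i := (j - k) / 2) (by omega) hα.1
        rw [hψ' (by omega), h1 _ (by omega), coeff_ser, ← e] at h3
        exact h3
    · by_cases hjs : j < s
      · rw [hγ.2.2.1 j hjs (by omega), hβ.2.2.1 j hjs (by omega)]
      · have e : j = s + 2 * ((j - s) / 2) := by omega
        have h3 := coeff_ser_smul ψ α (k := s) (i := (j - s) / 2) (by omega) hα.2.2.1
        rw [hψ' (by omega), h2 _ (by omega), coeff_ser, ← e] at h3
        exact h3
  rcases eq_or_lt_of_le hk with rfl | hlt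
  · refine ⟨A' * A⁻¹, ?_, fun i hi => ?_, fun i hi => ?_⟩
    · rw [PowerSeries.coeff_zero_eq_constantCoeff_apply, map_mul, PowerSeries.constantCoeff_inv]
      exact mul_ne_zero hA' (inv_ne_zero hA)
    · rw [mul_assoc, PowerSeries.inv_mul_cancel _ hA, mul_one, coeff_ser]
    · rw [show A' * A⁻¹ * ser α.x s = (ser α.x s * A⁻¹) * A' by ring,
        coeff_mul_eq_of_dvd_sub hquot (by omega), mul_assoc, PowerSeries.inv_mul_cancel _ hA',
        mul_one, coeff_ser]
  · -- here the order is attained by the entries of the parity of `s`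
    have hns : n % 2 = s % 2 := by
      by_contra hp
      exact hxα.2 (hα.1 n hlt (by omega))
    have hsn : s ≤ n := by
      by_contra hp
      exact hxα.2 (hα.2.2.1 n (by omega) hns)
    have hshift : ∀ γ : HeckeRep d, (∀ j < n, γ.x j = 0) →
        ser γ.x s = PowerSeries.X ^ ((n - s) / 2) * ser γ.x n :=
      fun γ hγ => ser_eq_X_pow_mul hsn hns fun j hj _ => hγ j hj
    have hB : PowerSeries.constantCoeff (ser α.x n) ≠ 0 := by rw [constantCoeff_ser]; exact hxα.2
    have hB' : PowerSeries.constantCoeff (ser β.x n) ≠ 0 := by rw [constantCoeff_ser]; exact hxβ.2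
    rw [hshift α hxα.1, hshift β hxβ.1] at hquot
    set B := ser α.x n with hBdef
    set B' := ser β.x n with hBdef'
    have hquot' : PowerSeries.X ^ ((d - k - n) / 2) ∣ B * A⁻¹ - B' * A'⁻¹ := by
      rw [mul_assoc, mul_assoc, ← mul_sub,
        show (d - k - s) / 2 = (n - s) / 2 + (d - k - n) / 2 by omega, pow_add] at hquot
      exact (mul_dvd_mul_iff_left (pow_ne_zero _ PowerSeries.X_ne_zero)).1 hquot
    have hcross : PowerSeries.X ^ ((d - k - n) / 2) ∣ B' * B⁻¹ * A - A' := by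
      have e : B' * B⁻¹ * A - A' = (-(A * A' * B⁻¹)) * (B * A⁻¹ - B' * A'⁻¹) := by
        linear_combination (A' * A * A⁻¹) * PowerSeries.inv_mul_cancel B hB
          + A' * PowerSeries.mul_inv_cancel A hA
          - (B' * B⁻¹ * A) * PowerSeries.mul_inv_cancel A' hA'
      rw [e]
      exact Dvd.dvd.mul_left hquot' _
    refine ⟨B' * B⁻¹, ?_, fun i hi => ?_, fun i hi => ?_⟩
    · rw [PowerSeries.coeff_zero_eq_constantCoeff_apply, map_mul, PowerSeries.constantCoeff_inv]
      exact mul_ne_zero hB' (inv_ne_zero hB)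
    · rw [powerSeries_dvd_sub_iff.1 hcross i (by omega), coeff_ser]
    · rw [hshift α hxα.1, show B' * B⁻¹ * (PowerSeries.X ^ ((n - s) / 2) * B) =
        PowerSeries.X ^ ((n - s) / 2) * B' * (B⁻¹ * B) by ring,
        PowerSeries.inv_mul_cancel _ hB, mul_one, ← hshift β hxβ.1, coeff_ser]

/-- A point of a chart with prescribed coordinates `c`: the entry of the parity of `k` is `z ^ k`,
the other one is `∑ c_i z ^ (s + 2 i) + z ^ (d - k)`. The last summand does not affect the
coordinates; it provides a nonzero coefficient of index `d - k` if all coordinates vanish. -/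
theorem exists_chartCoord_eq {d k s : ℕ} (hc : IsChart d k s) (c : ℕ → ℂ) :
    ∃ α ∈ chartReps d k s, (∀ i < (d - k - s) / 2, chartCoord k s α.x i = c i) ∧
      (∀ i < (d - k - s) / 2, α.x (s + 2 * i) = c i) ∧ (0 < k → α.x (d - k) = 1) := by
  have hpar := hc.parity
  have hodd := hc.odd
  have hle := hc.le
  have hlt := hc.lt
  obtain ⟨x, hx⟩ : ∃ x : ℕ → ℂ, x = fun j => if j % 2 = k % 2 then (if j = k then 1 else 0) else
      if j < s then 0 else if j < d - k then c ((j - s) / 2) else if j = d - k then 1 else 0 :=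
    ⟨_, rfl⟩
  have hxk : x k = 1 := by simp [hx]
  have hxd : x (d - k) = 1 := by
    rw [hx]
    dsimp only
    rw [if_neg (by omega), if_neg (by omega), if_neg (by omega), if_pos rfl]
  have hmin : x (min k (d - k)) ≠ 0 := by
    rcases min_choice k (d - k) with h | h <;> rw [h] <;> simp [hxk, hxd]
  obtain ⟨α, hα⟩ := HeckeRep.exists_x_eq (d := d) x (n := min k (d - k)) (by omega) hmin
  have hαs : ∀ i < (d - k - s) / 2, α.x (s + 2 * i) = c i := by
    intro i hi
    rw [hα _ (by omega), hx]
    dsimp only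
    rw [if_neg (by omega), if_neg (by omega), if_pos (by omega)]
    congr 1
    omega
  have hmem : α ∈ chartReps d k s := by
    refine ⟨fun j hj hp => ?_, ?_, fun j hj hp => ?_, min k (d - k), by omega, ?_⟩
    · rw [hα j (by omega), hx]
      dsimp only
      rw [if_pos hp, if_neg (by omega)]
    · rw [hα k hlt, hxk]
      exact one_ne_zero
    · rw [hα j (by omega), hx]
      dsimp only
      rw [if_neg (by omega), if_pos hj]
    · rwa [hα _ (by omega)]
  refine ⟨α, hmem, fun i hi => ?_, hαs, fun hk => (hα _ (by omega)).trans hxd⟩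
  have hA : ser α.x k = 1 := by
    ext i
    rw [coeff_ser, PowerSeries.coeff_one]
    by_cases hi : k + 2 * i < d
    · rw [hα _ hi, hx]
      dsimp only
      rw [if_pos (by omega)]
      refine if_congr (by omega) rfl rfl
    · rw [α.x_of_le (not_lt.1 hi), if_neg (by omega)]
  rw [chartCoord, hA, inv_one, mul_one, coeff_ser, hαs i hi]

/-! ### Overlaps of charts -/

theorem chartCoord_eq_ite {k s r : ℕ} {x : ℕ → ℂ} (hsr : s ≤ r) (hp : r % 2 = s % 2)
    (h : ∀ j < r, j % 2 = s % 2 → x j = 0) (i : ℕ) :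
    chartCoord k s x i = if s + 2 * i < r then 0 else chartCoord k r x (i - (r - s) / 2) := by
  rw [chartCoord, ser_eq_X_pow_mul hsr hp h, mul_assoc, PowerSeries.coeff_X_pow_mul']
  split_ifs with h1 h2 h2
  · omega
  · rfl
  · rfl
  · omega

theorem exists_equiv_of_cls_eq {d k s : ℕ} (hc : IsChart d k s) {α β : HeckeRep d}
    (hα : α ∈ chartReps d k s) (h : α.cls = β.cls) :
    ∃ γ ∈ chartReps d k s, (∀ i < (d - k - s) / 2, chartCoord k s γ.x i = chartCoord k s α.x i) ∧
      ∃ n, (∀ j < n, γ.x j = 0) ∧ γ.x n ≠ 0 ∧ (∀ j < n, β.x j = 0) ∧ β.x n ≠ 0 ∧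
        n ≤ k ∧ n ≤ d - k ∧ ∀ j < d - n, γ.x j = β.x j := by
  obtain ⟨φ, hφ⟩ := (α.cls_eq_iff β).1 h
  have hγ := smul_mem_chartReps hc φ hα
  refine ⟨φ • α, hγ, fun i hi => chartCoord_smul hc φ hα hi, ?_⟩
  obtain ⟨n, h1, h2, h3⟩ := (HeckeRep.equiv_iff _ _).1 hφ
  obtain ⟨n', h1', hk, hdk, -⟩ := exists_ord_of_mem hγ
  obtain rfl := h1.unique h1'
  rw [HeckeRep.hasOrd_iff] at h1 h2
  exact ⟨n, h1.1, h1.2, h2.1, h2.2, hk, hdk, h3⟩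

theorem le_of_mem_chartReps {d k s n : ℕ} {β : HeckeRep d} (hβ : β ∈ chartReps d k s)
    (hn : ∀ j < n, β.x j = 0) : n ≤ k ∧ n ≤ d - k := by
  obtain ⟨-, h2, -, j, hj, hj'⟩ := hβ
  constructor
  · by_contra hc
    exact h2 (hn k (by omega))
  · by_contra hc
    exact hj' (hn j (by omega))

/-- Charts whose distinguished entries are of the same parity, but of different orders, are
disjoint. -/
theorem eq_of_cls_eq_of_parity {d k s k' s' : ℕ} (hc : IsChart d k s) (hc' : IsChart d k' s')
    (hp : k % 2 = k' % 2) {α β : HeckeRep d} (hα : α ∈ chartReps d k s)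
    (hβ : β ∈ chartReps d k' s') (h : α.cls = β.cls) : k = k' := by
  obtain ⟨γ, hγ, -, n, -, -, hβ0, -, hnk, hnd, hj⟩ := exists_equiv_of_cls_eq hc hα h
  obtain ⟨hnk', hnd'⟩ := le_of_mem_chartReps hβ hβ0
  have := hc.lt
  have := hc'.lt
  rcases lt_trichotomy k k' with hlt | heq | hgt
  · have h1 := hj k (by omega)
    rw [hβ.1 k hlt hp] at h1
    exact absurd h1 hγ.2.1
  · exact heq
  · have h1 := hj k' (by omega)
    rw [hγ.1 k' hgt hp.symm] at h1
    exact absurd h1.symm hβ.2.1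

theorem chartReps_mono {d k s r : ℕ} (hsr : s ≤ r) (hp : r % 2 = s % 2) :
    chartReps d k r ⊆ chartReps d k s := by
  rintro α ⟨h1, h2, h3, h4⟩
  exact ⟨h1, h2, fun j hj hj' => h3 j (by omega) (by omega), h4⟩

/-- The coordinate change between two charts with the same distinguished entry is a shift of the
coordinates. Here `c` is any sequence that extends the invariant coordinates of `α`. -/
theorem overlap_same {d k s s' : ℕ} (hc : IsChart d k s) (hc' : IsChart d k s')
    {α β : HeckeRep d} (hα : α ∈ chartReps d k s) (hβ : β ∈ chartReps d k s')
    (h : α.cls = β.cls) {c : ℕ → ℂ} (hcα : ∀ i < (d - k - s) / 2, chartCoord k s α.x i = c i) :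
    (∀ i < (d - k - s) / 2, s + 2 * i < s' → c i = 0) ∧
    ∀ i < (d - k - s') / 2, chartCoord k s' β.x i =
      if s' + 2 * i < s then 0 else c ((s' + 2 * i - s) / 2) := by
  have := hc.parity
  have := hc'.parity
  have := hc.le
  have := hc'.le
  rcases le_total s s' with hle | hle
  · have hβ' := chartReps_mono hle (by omega) hβ
    have h1 := fun i => chartCoord_eq_ite (k := k) hle (by omega)
      (fun j hj hj' => hβ.2.2.1 j hj (by omega)) i
    have h2 := fun i => chartCoord_eq_of_cls_eq hc hα hβ' h (i := i)
    constructor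
    · intro i hi hi'
      rw [← hcα i hi, h2 i hi, h1, if_pos hi']
    · intro i hi
      rw [if_neg (by omega), ← hcα _ (by omega), h2 _ (by omega), h1, if_neg (by omega)]
      congr 1
      omega
  · have hα' := chartReps_mono hle (by omega) hα
    have h1 := fun i => chartCoord_eq_ite (k := k) hle (by omega)
      (fun j hj hj' => hα.2.2.1 j hj (by omega)) i
    have h2 := fun i => chartCoord_eq_of_cls_eq hc' hα' hβ h (i := i)
    constructor
    · intro i hi hi'
      omega
    · intro i hi
      rw [← h2 i hi, h1]
      split_ifs
      · rfl
      · rw [← hcα _ (by omega)]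
        congr 1
        omega

/-- The coordinate change between two charts whose distinguished entries have different parity
inverts the power series formed by the coordinates, up to a power of `w`. Here `c` is any sequence
that extends the invariant coordinates of `α`. -/
theorem overlap_opposite {d k s k' s' : ℕ} (hc : IsChart d k s) (hc' : IsChart d k' s')
    (hp : k % 2 ≠ k' % 2) {α β : HeckeRep d} (hα : α ∈ chartReps d k s)
    (hβ : β ∈ chartReps d k' s') (h : α.cls = β.cls) {c : ℕ → ℂ}
    (hcα : ∀ i < (d - k - s) / 2, chartCoord k s α.x i = c i) :
    (s ≤ k' ∧ s' ≤ k ∧ k + k' ≤ d) ∧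
    (∀ i < (d - k - s) / 2, s + 2 * i < k' → c i = 0) ∧
    (∀ i < (d - k - s) / 2, s + 2 * i = k' → c i ≠ 0) ∧
    ∀ i < (d - k' - s') / 2, chartCoord k' s' β.x i =
      if s' + 2 * i < k then 0 else PowerSeries.coeff ((s' + 2 * i - k) / 2)
        (PowerSeries.mk fun l => c ((k' - s) / 2 + l))⁻¹ := by
  obtain ⟨γ, hγ, hcoord, n, hγ0, hγn, hβ0, hβn, hnk, hnd, hj⟩ := exists_equiv_of_cls_eq hc hα h
  obtain ⟨hnk', hnd'⟩ := le_of_mem_chartReps hβ hβ0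
  have hpar := hc.parity
  have hpar' := hc'.parity
  have hodd := hc.odd
  have hle := hc.le
  have hle' := hc'.le
  have hlt := hc.lt
  have hlt' := hc'.lt
  have hn : n = k ∨ n = k' := by
    by_cases hpn : n % 2 = k % 2
    · refine Or.inl (hnk.antisymm ?_)
      by_contra hcon
      exact hγn (hγ.1 n (by omega) hpn)
    · refine Or.inr (hnk'.antisymm ?_)
      by_contra hcon
      exact hβn (hβ.1 n (by omega) (by omega))
  -- the coefficients of index `k` and `k'` of both representatives
  have hβk : k < d - n → β.x k ≠ 0 := fun hk => by
    rw [← hj k hk]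
    exact hγ.2.1
  have hγk : k' < d - n → γ.x k' ≠ 0 := fun hk => by
    rw [hj k' hk]
    exact hβ.2.1
  have hsum : k + k' ≤ d := by omega
  have hs : s ≤ k' := by
    by_contra hcon
    exact hγk (by omega) (hγ.2.2.1 k' (by omega) (by omega))
  have hs' : s' ≤ k := by
    by_contra hcon
    exact hβk (by omega) (hβ.2.2.1 k (by omega) (by omega))
  have hγv : ∀ j < k', j % 2 = s % 2 → γ.x j = 0 := fun j h1 h2 => by
    rw [hj j (by omega)]
    exact hβ.1 j h1 (by omega)
  have hβv : ∀ j < k, j % 2 = s' % 2 → β.x j = 0 := fun j h1 h2 => by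
    rw [← hj j (by omega)]
    exact hγ.1 j h1 (by omega)
  have h1 := fun i => chartCoord_eq_ite (k := k) hs (by omega) hγv i
  have h2 := fun i => chartCoord_eq_ite (k := k') hs' (by omega) hβv i
  refine ⟨⟨hs, hs', hsum⟩, fun i hi hi' => ?_, fun i hi hi' => ?_, fun i hi => ?_⟩
  · rw [← hcα i hi, ← hcoord i hi, h1, if_pos hi']
  · rw [← hcα i hi, ← hcoord i hi, h1, if_neg (by omega),
      show i - (k' - s) / 2 = 0 by omega, chartCoord,
      PowerSeries.coeff_zero_eq_constantCoeff_apply, map_mul, PowerSeries.constantCoeff_inv,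
      constantCoeff_ser, constantCoeff_ser]
    exact mul_ne_zero (hγk (by omega)) (inv_ne_zero hγ.2.1)
  · rw [h2]
    refine ite_congr rfl (fun _ => rfl) fun hi' => ?_
    have hA : PowerSeries.constantCoeff (ser γ.x k) ≠ 0 := by
      rw [constantCoeff_ser]
      exact hγ.2.1
    have hB : PowerSeries.constantCoeff (ser γ.x k') ≠ 0 := by
      rw [constantCoeff_ser]
      exact hγk (by omega)
    have hB' : PowerSeries.constantCoeff (ser β.x k') ≠ 0 := by
      rw [constantCoeff_ser]
      exact hβ.2.1
    set q := ser γ.x k' * (ser γ.x k)⁻¹ with hq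
    have hq0 : PowerSeries.constantCoeff q ≠ 0 := by
      rw [hq, map_mul, PowerSeries.constantCoeff_inv]
      exact mul_ne_zero hB (inv_ne_zero hA)
    set q' : PowerSeries ℂ := PowerSeries.mk fun l => c ((k' - s) / 2 + l)
      with hq'
    have hqq : PowerSeries.X ^ ((d - k - k') / 2) ∣ q' - q := by
      refine powerSeries_dvd_sub_iff.2 fun l hl => ?_
      rw [hq', PowerSeries.coeff_mk, ← hcα _ (by omega), ← hcoord _ (by omega), h1,
        if_neg (by omega), Nat.add_sub_cancel_left, chartCoord]
    have hq0' : PowerSeries.constantCoeff q' ≠ 0 := by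
      rwa [← PowerSeries.coeff_zero_eq_constantCoeff_apply,
        powerSeries_dvd_sub_iff.1 hqq 0 (by omega), PowerSeries.coeff_zero_eq_constantCoeff_apply]
    have e1 : PowerSeries.X ^ ((d - k - k') / 2) ∣ 1 * q'⁻¹ - 1 * q⁻¹ :=
      dvd_quot_sub (t := 0) hq0' hq0 (by simp) hqq (by simp) (by omega)
    have e2 : PowerSeries.X ^ ((d - k - k') / 2) ∣
        ser γ.x k * (ser γ.x k')⁻¹ - ser β.x k * (ser β.x k')⁻¹ := by
      refine dvd_quot_sub (t := 0) (p := (d - k - k') / 2) hB hB' (by simp) ?_ ?_ (by omega)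
      · refine powerSeries_dvd_sub_iff.2 fun l hl => ?_
        rw [coeff_ser, coeff_ser, hj _ (by omega)]
      · refine powerSeries_dvd_sub_iff.2 fun l hl => ?_
        rw [coeff_ser, coeff_ser, hj _ (by omega)]
    have e3 : q⁻¹ = ser γ.x k * (ser γ.x k')⁻¹ := by
      rw [PowerSeries.inv_eq_iff_mul_eq_one hq0, hq]
      linear_combination (ser γ.x k' * (ser γ.x k')⁻¹) * PowerSeries.mul_inv_cancel _ hA
        + PowerSeries.mul_inv_cancel _ hB
    rw [one_mul, one_mul, e3] at e1
    rw [show (s' + 2 * i - k) / 2 = i - (k - s') / 2 by omega,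
      powerSeries_dvd_sub_iff.1 e1 _ (by omega), powerSeries_dvd_sub_iff.1 e2 _ (by omega),
      chartCoord]

/-- Every point of a chart whose coordinates of small index vanish lies in the smaller chart with
the same distinguished entry. -/
theorem exists_mem_inter_same {d k s s' : ℕ} (hc : IsChart d k s) (hc' : IsChart d k s')
    {c : ℕ → ℂ} (h0 : ∀ i < (d - k - s) / 2, s + 2 * i < s' → c i = 0) :
    ∃ α ∈ chartReps d k s, α ∈ chartReps d k s' ∧
      ∀ i < (d - k - s) / 2, chartCoord k s α.x i = c i := by
  obtain ⟨α, hα, h1, h2, -⟩ := exists_chartCoord_eq hc c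
  have := hc.parity
  have := hc'.parity
  have := hc.le
  have := hc'.le
  have := hc.odd
  refine ⟨α, hα, ⟨hα.1, hα.2.1, fun j hj hj' => ?_, hα.2.2.2⟩, h1⟩
  by_cases hs : j < s
  · exact hα.2.2.1 j hs (by omega)
  · have h3 := h2 ((j - s) / 2) (by omega)
    rwa [h0 _ (by omega) (by omega), show s + 2 * ((j - s) / 2) = j by omega] at h3

theorem exists_mem_inter_opposite {d k s k' s' : ℕ} (hc : IsChart d k s) (hc' : IsChart d k' s')
    (hp : k % 2 ≠ k' % 2) (hs : s ≤ k') (hs' : s' ≤ k) (hsum : k + k' ≤ d) {c : ℕ → ℂ}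
    (h0 : ∀ i < (d - k - s) / 2, s + 2 * i < k' → c i = 0)
    (h1 : ∀ i < (d - k - s) / 2, s + 2 * i = k' → c i ≠ 0) :
    ∃ α ∈ chartReps d k s, α ∈ chartReps d k' s' ∧
      ∀ i < (d - k - s) / 2, chartCoord k s α.x i = c i := by
  obtain ⟨α, hα, h2, h3, h4⟩ := exists_chartCoord_eq hc c
  have := hc.parity
  have := hc'.parity
  have := hc.odd
  have := hc'.lt
  refine ⟨α, hα, ⟨fun j hj hj' => ?_, ?_, fun j hj hj' => hα.1 j (by omega) (by omega),
    k, by omega, hα.2.1⟩, h2⟩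
  · by_cases hjs : j < s
    · exact hα.2.2.1 j hjs (by omega)
    · have h5 := h3 ((j - s) / 2) (by omega)
      rwa [h0 _ (by omega) (by omega), show s + 2 * ((j - s) / 2) = j by omega] at h5
  · rcases eq_or_lt_of_le hsum with heq | hlt
    · rw [show k' = d - k by omega, h4 (by omega)]
      exact one_ne_zero
    · have h5 := h3 ((k' - s) / 2) (by omega)
      rw [show s + 2 * ((k' - s) / 2) = k' by omega] at h5
      rw [h5]
      exact h1 _ (by omega) (by omega)

/-! ### Regular functions on the complement of a hypersurface -/

section Regular

variable {ι : Type}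

/-- The function `f` agrees on `S` with a quotient of a polynomial by a power of `D`. -/
def IsRegular (D : MvPolynomial ι ℂ) (S : Set (ι → ℂ)) (f : (ι → ℂ) → ℂ) : Prop :=
  ∃ (N : ℕ) (p : MvPolynomial ι ℂ), ∀ y ∈ S,
    MvPolynomial.eval y p = MvPolynomial.eval y D ^ N * f y

variable {D : MvPolynomial ι ℂ} {S : Set (ι → ℂ)} {f g : (ι → ℂ) → ℂ}

theorem IsRegular.eval (p : MvPolynomial ι ℂ) : IsRegular D S fun y => MvPolynomial.eval y p :=
  ⟨0, p, fun y _ => by rw [pow_zero, one_mul]⟩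

theorem IsRegular.const (c : ℂ) : IsRegular D S fun _ => c :=
  ⟨0, MvPolynomial.C c, fun y _ => by rw [pow_zero, one_mul, MvPolynomial.eval_C]⟩

theorem IsRegular.congr (hf : IsRegular D S f) (h : ∀ y ∈ S, f y = g y) : IsRegular D S g := by
  obtain ⟨N, p, hp⟩ := hf
  exact ⟨N, p, fun y hy => by rw [hp y hy, h y hy]⟩

theorem IsRegular.add (hf : IsRegular D S f) (hg : IsRegular D S g) :
    IsRegular D S fun y => f y + g y := by
  obtain ⟨N, p, hp⟩ := hf
  obtain ⟨M, q, hq⟩ := hg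
  refine ⟨N + M, D ^ M * p + D ^ N * q, fun y hy => ?_⟩
  rw [map_add, map_mul, map_mul, map_pow, map_pow, hp y hy, hq y hy]
  ring

theorem IsRegular.mul (hf : IsRegular D S f) (hg : IsRegular D S g) :
    IsRegular D S fun y => f y * g y := by
  obtain ⟨N, p, hp⟩ := hf
  obtain ⟨M, q, hq⟩ := hg
  refine ⟨N + M, p * q, fun y hy => ?_⟩
  rw [map_mul, hp y hy, hq y hy]
  ring

theorem IsRegular.neg (hf : IsRegular D S f) : IsRegular D S fun y => -f y :=
  ((IsRegular.const (-1)).mul hf).congr fun _ _ => neg_one_mul _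

theorem IsRegular.pow (hf : IsRegular D S f) (n : ℕ) : IsRegular D S fun y => f y ^ n := by
  induction n with
  | zero => exact (IsRegular.const 1).congr fun y _ => (pow_zero _).symm
  | succ n ih => exact (ih.mul hf).congr fun y _ => (pow_succ _ _).symm

theorem IsRegular.sum {κ : Type} (s : Finset κ) {F : κ → (ι → ℂ) → ℂ}
    (h : ∀ i ∈ s, IsRegular D S (F i)) : IsRegular D S fun y => ∑ i ∈ s, F i y := by
  classical
  induction s using Finset.induction_on with
  | empty => exact (IsRegular.const 0).congr fun y _ => by rw [Finset.sum_empty]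
  | insert a s ha ih =>
    refine ((h a (Finset.mem_insert_self a s)).add
      (ih fun i hi => h i (Finset.mem_insert_of_mem hi))).congr fun y _ => ?_
    rw [Finset.sum_insert ha]

/-- A divisor of `D` has a regular inverse. -/
theorem IsRegular.inv (hg : IsRegular D S g) (hD : ∀ y ∈ S, MvPolynomial.eval y D ≠ 0)
    (h : ∀ y ∈ S, f y * g y = MvPolynomial.eval y D) : IsRegular D S fun y => (f y)⁻¹ := by
  obtain ⟨N, p, hp⟩ := hg
  refine ⟨N + 1, p, fun y hy => ?_⟩
  have hf : f y ≠ 0 := by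
    intro h0
    exact hD y hy (by rw [← h y hy, h0, zero_mul])
  rw [hp y hy, pow_succ, mul_assoc, ← h y hy]
  field_simp

theorem IsRegular.coeff_mul {F G : (ι → ℂ) → PowerSeries ℂ} {i : ℕ}
    (hF : ∀ l ≤ i, IsRegular D S fun y => PowerSeries.coeff l (F y))
    (hG : ∀ l ≤ i, IsRegular D S fun y => PowerSeries.coeff l (G y)) :
    IsRegular D S fun y => PowerSeries.coeff i (F y * G y) := by
  simp only [PowerSeries.coeff_mul]
  refine IsRegular.sum _ fun p hp => ?_
  rw [Finset.HasAntidiagonal.mem_antidiagonal] at hp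
  exact (hF _ (by omega)).mul (hG _ (by omega))

theorem IsRegular.coeff_inv {F : (ι → ℂ) → PowerSeries ℂ} {i : ℕ}
    (hF : ∀ l ≤ i, IsRegular D S fun y => PowerSeries.coeff l (F y))
    (h0 : IsRegular D S fun y => (PowerSeries.constantCoeff (F y))⁻¹) :
    IsRegular D S fun y => PowerSeries.coeff i (F y)⁻¹ := by
  induction i using Nat.strong_induction_on with
  | _ i ih =>
    refine IsRegular.congr ?_ fun y _ => (PowerSeries.coeff_inv i (F y)).symm
    rcases Nat.eq_zero_or_pos i with rfl | hi
    · simpa using h0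
    · simp only [hi.ne', if_false]
      refine h0.neg.mul (IsRegular.sum _ fun p hp => ?_)
      rw [Finset.HasAntidiagonal.mem_antidiagonal] at hp
      by_cases hp2 : p.2 < i
      · simp only [hp2, if_true]
        exact (hF _ (by omega)).mul (ih _ hp2 fun l hl => hF l (by omega))
      · simp only [hp2, if_false]
        exact IsRegular.const 0

/-- Clearing denominators: regular functions become polynomials after multiplication by powers of
`D`, and the powers can be chosen in proportion to given positive weights. -/
theorem IsRegular.exists_polynomial {m : ℕ} {w : Fin m → ℕ} (hw : ∀ j, 1 ≤ w j)
    {h : Fin m → (ι → ℂ) → ℂ} (hh : ∀ j, IsRegular D S (h j)) :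
    ∃ (M : ℕ) (F : Fin m → MvPolynomial ι ℂ), ∀ y ∈ S, ∀ j,
      MvPolynomial.eval y (F j) = (MvPolynomial.eval y D ^ M) ^ w j * h j y := by
  choose N p hp using hh
  refine ⟨∑ j, N j, fun j => D ^ ((∑ j, N j) * w j - N j) * p j, fun y hy j => ?_⟩
  have hle : N j ≤ (∑ j, N j) * w j :=
    (Finset.single_le_sum (fun i _ => Nat.zero_le (N i)) (Finset.mem_univ j)).trans
      (Nat.le_mul_of_pos_right _ (hw j))
  rw [map_mul, map_pow, hp j y hy, ← mul_assoc, ← pow_add, Nat.sub_add_cancel hle, pow_mul]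

end Regular

/-! ### The affine chart of a weighted projective space -/

/-- The vector `(1, c_0, c_1, …)`. -/
def homog (c : ℕ → ℂ) (j : ℕ) : ℂ := if j = 0 then 1 else c (j - 1)

theorem homog_zero (c : ℕ → ℂ) : homog c 0 = 1 := if_pos rfl

theorem homog_succ (c : ℕ → ℂ) (j : ℕ) : homog c (j + 1) = c j := if_neg (Nat.succ_ne_zero j)

section Affine

variable {m : ℕ} (w : Fin (m + 1) → ℕ)

/-- The point `(1 : c_0 : … : c_{m - 1})` of a weighted projective space. -/
def affinePoint (c : ℕ → ℂ) : WProj w :=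
  WProj.mk w (fun j => homog c j) fun h => by
    have := congrFun h 0
    rw [Fin.val_zero, homog_zero] at this
    exact one_ne_zero this

variable {w}

theorem mk_eq_mk_iff {y y' : Fin (m + 1) → ℂ} (hy : y ≠ 0) (hy' : y' ≠ 0) :
    WProj.mk w y hy = WProj.mk w y' hy' ↔ ∃ c : ℂ, c ≠ 0 ∧ ∀ j, y' j = c ^ w j * y j := by
  refine (Quotient.eq (r := wprojSetoid w)).trans ?_
  constructor
  · rintro ⟨c, hc⟩
    exact ⟨c, c.ne_zero, hc⟩
  · rintro ⟨c, hc, h⟩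
    exact ⟨Units.mk0 c hc, h⟩

theorem affinePoint_congr {c c' : ℕ → ℂ} (h : ∀ i < m, c i = c' i) :
    affinePoint w c = affinePoint w c' := by
  refine (mk_eq_mk_iff _ _).2 ⟨1, one_ne_zero, fun j => ?_⟩
  rw [one_pow, one_mul]
  rcases j with ⟨j, hj⟩
  rcases j with - | j
  · rfl
  · change homog c' (j + 1) = homog c (j + 1)
    rw [homog_succ, homog_succ, h j (by omega)]

theorem mk_eq_affinePoint {y : Fin (m + 1) → ℂ} {c : ℕ → ℂ} {b : ℂ} (hb : b ≠ 0)
    (h : ∀ j, y j = b ^ w j * homog c j) : ∃ hy : y ≠ 0, affinePoint w c = WProj.mk w y hy := by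
  have hy : y ≠ 0 := by
    intro h0
    have h1 := h 0
    rw [h0, Fin.val_zero, homog_zero, mul_one] at h1
    exact pow_ne_zero _ hb h1.symm
  exact ⟨hy, (mk_eq_mk_iff _ _).2 ⟨b, hb, h⟩⟩

theorem mem_cone_affinePoint (hw : w 0 = 1) {y : Fin (m + 1) → ℂ} {c : ℕ → ℂ} :
    y ∈ WProj.cone {affinePoint w c} ↔ y 0 ≠ 0 ∧ ∀ j, y j = y 0 ^ w j * homog c j := by
  constructor
  · rintro ⟨hy, h⟩
    obtain ⟨b, hb, h⟩ := (mk_eq_mk_iff _ _).1 (Set.mem_singleton_iff.1 h).symm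
    have h0 := h 0
    rw [hw, pow_one, Fin.val_zero, homog_zero, mul_one] at h0
    rw [h0]
    exact ⟨hb, h⟩
  · rintro ⟨h0, h⟩
    obtain ⟨hy, h1⟩ := mk_eq_affinePoint h0 h
    exact ⟨hy, h1.symm⟩

theorem affinePoint_injective (hw : w 0 = 1) {c c' : ℕ → ℂ}
    (h : affinePoint w c = affinePoint w c') : ∀ i < m, c i = c' i := by
  intro i hi
  obtain ⟨b, hb, h⟩ := (mk_eq_mk_iff _ _).1 h
  have h0 := h 0
  rw [hw, pow_one, Fin.val_zero, homog_zero, homog_zero, mul_one] at h0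
  have h1 := h ⟨i + 1, by omega⟩
  rw [← h0, one_pow, one_mul] at h1
  change homog c' (i + 1) = homog c (i + 1) at h1
  rw [homog_succ, homog_succ] at h1
  exact h1.symm

theorem isNonsingular_affinePoint (hw : w 0 = 1) (c : ℕ → ℂ) :
    (affinePoint w c).IsNonsingular := by
  intro y hy b hb
  have h0 := ((mem_cone_affinePoint hw).1 hy).1
  have h1 := hb 0
  rw [hw, pow_one] at h1
  exact Units.ext (mul_right_cancel₀ h0 (by rw [h1, Units.val_one, one_mul]))

/-- The affine coordinates `y_{i + 1} / y_0 ^ w_{i + 1}` of a point with homogeneous coordinates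
`y`. -/
def affineCoord (w : Fin (m + 1) → ℕ) (y : Fin (m + 1) → ℂ) (i : ℕ) : ℂ :=
  if h : i < m then y (⟨i, h⟩ : Fin m).succ / y 0 ^ w (⟨i, h⟩ : Fin m).succ else 0

theorem affineCoord_val (y : Fin (m + 1) → ℂ) (i : Fin m) :
    affineCoord w y i = y i.succ / y 0 ^ w i.succ := dif_pos i.2

theorem affineCoord_of_mem_cone (hw : w 0 = 1) {y : Fin (m + 1) → ℂ} {c : ℕ → ℂ}
    (h : y ∈ WProj.cone {affinePoint w c}) {i : ℕ} (hi : i < m) : affineCoord w y i = c i := by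
  obtain ⟨h0, h1⟩ := (mem_cone_affinePoint hw).1 h
  have h2 := affineCoord_val (w := w) y ⟨i, hi⟩
  rw [h1 (⟨i, hi⟩ : Fin m).succ, Fin.val_succ, homog_succ,
    mul_div_cancel_left₀ _ (pow_ne_zero _ h0)] at h2
  exact h2

/-- The locus in the affine chart where the coordinates with indices in `Z` vanish and those with
indices in `U` do not. -/
def toricLocus (w : Fin (m + 1) → ℕ) (Z U : Set ℕ) : Set (WProj w) :=
  {p | ∃ c : ℕ → ℂ, (∀ i < m, i ∈ Z → c i = 0) ∧ (∀ i < m, i ∈ U → c i ≠ 0) ∧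
    p = affinePoint w c}

theorem cone_toricLocus (hw : w 0 = 1) (Z U : Set ℕ) :
    WProj.cone (toricLocus w Z U) = {y | y 0 ≠ 0 ∧ ∀ i : Fin m,
      ((i : ℕ) ∈ Z → y i.succ = 0) ∧ ((i : ℕ) ∈ U → y i.succ ≠ 0)} := by
  ext y
  constructor
  · rintro ⟨hy, c, hZ, hU, hp⟩
    obtain ⟨h0, h1⟩ := (mem_cone_affinePoint hw).1 ⟨hy, hp⟩
    refine ⟨h0, fun i => ?_⟩
    rw [h1 i.succ, Fin.val_succ, homog_succ]
    exact ⟨fun hi => by rw [hZ i i.2 hi, mul_zero],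
      fun hi => mul_ne_zero (pow_ne_zero _ h0) (hU i i.2 hi)⟩
  · rintro ⟨h0, h1⟩
    have hmem : y ∈ WProj.cone {affinePoint w (affineCoord w y)} := by
      refine (mem_cone_affinePoint hw).2 ⟨h0, fun j => ?_⟩
      refine Fin.cases ?_ (fun i => ?_) j
      · rw [hw, pow_one, Fin.val_zero, homog_zero, mul_one]
      · rw [Fin.val_succ, homog_succ, affineCoord_val, mul_div_cancel₀ _ (pow_ne_zero _ h0)]
    obtain ⟨hy, hp⟩ := hmem
    refine ⟨hy, affineCoord w y, fun i hi hZ => ?_, fun i hi hU => ?_, hp⟩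
    · rw [affineCoord_val y ⟨i, hi⟩, (h1 ⟨i, hi⟩).1 hZ, zero_div]
    · rw [affineCoord_val y ⟨i, hi⟩]
      exact div_ne_zero ((h1 ⟨i, hi⟩).2 hU) (pow_ne_zero _ h0)

theorem isToric_toricLocus (hw : w 0 = 1) (Z U : Set ℕ) : WProj.IsToric (toricLocus w Z U) := by
  classical
  constructor
  · rw [cone_toricLocus hw]
    refine ⟨{p | ∃ i : Fin m, (i : ℕ) ∈ Z ∧ p = MvPolynomial.X i.succ},
      {MvPolynomial.X 0 * ∏ i ∈ Finset.univ.filter fun i : Fin m => (i : ℕ) ∈ U,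
        MvPolynomial.X i.succ}, ?_⟩
    ext y
    simp only [Set.mem_ofPred_eq, Set.mem_singleton_iff, exists_eq_left, map_mul, map_prod,
      MvPolynomial.eval_X, mul_ne_zero_iff, Finset.prod_ne_zero_iff, Finset.mem_filter,
      Finset.mem_univ, true_and]
    constructor
    · rintro ⟨h0, h1⟩
      refine ⟨?_, h0, fun i hi => (h1 i).2 hi⟩
      rintro p ⟨i, hi, rfl⟩
      rw [MvPolynomial.eval_X]
      exact (h1 i).1 hi
    · rintro ⟨h1, h0, h2⟩
      refine ⟨h0, fun i => ⟨fun hi => ?_, h2 i⟩⟩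
      simpa using h1 _ ⟨i, hi, rfl⟩
  · intro t y hy
    rw [cone_toricLocus hw] at hy ⊢
    refine ⟨mul_ne_zero (t 0).ne_zero hy.1, fun i => ⟨fun hi => ?_, fun hi => ?_⟩⟩
    · exact mul_eq_zero_of_right _ ((hy.2 i).1 hi)
    · exact mul_ne_zero (t i.succ).ne_zero ((hy.2 i).2 hi)

theorem isToric_empty : WProj.IsToric (∅ : Set (WProj w)) := by
  have h : WProj.cone (∅ : Set (WProj w)) = ∅ := by
    ext y
    simp [WProj.cone]
  constructor
  · rw [h]
    exact ⟨∅, ∅, by ext y; simp⟩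
  · intro t y hy
    rw [h] at hy
    exact absurd hy (Set.notMem_empty y)

end Affine

/-! ### The coefficient vectors of the points of a chart -/

/-- Extension of a coefficient vector by zero. -/
def extend {d : ℕ} (y : Fin d → ℂ) (j : ℕ) : ℂ := if h : j < d then y ⟨j, h⟩ else 0

theorem extend_coords {d : ℕ} (α : HeckeRep d) : extend α.coords = α.x := by
  funext j
  rw [extend]
  split_ifs with h
  · exact α.coords_apply ⟨j, h⟩
  · exact (α.x_of_le (not_lt.1 h)).symm

theorem coords_image_chartReps {d k s : ℕ} (hc : IsChart d k s) :
    HeckeRep.coords '' chartReps d k s =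
      {y | (∀ j ∈ {j : Fin d | ((j : ℕ) < k ∧ (j : ℕ) % 2 = k % 2) ∨
          ((j : ℕ) < s ∧ (j : ℕ) % 2 = s % 2)}, y j = 0) ∧
        y ⟨k, hc.lt⟩ ≠ 0 ∧ ∃ j ∈ {j : Fin d | (j : ℕ) ≤ d - k}, y j ≠ 0} := by
  have hlt := hc.lt
  have hle := hc.le
  have hodd := hc.odd
  ext y
  constructor
  · rintro ⟨α, ⟨h1, h2, h3, j, hj, hj'⟩, rfl⟩
    have hjd : j < d := by
      by_contra h
      exact hj' (α.x_of_le (not_lt.1 h))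
    refine ⟨?_, ?_, ⟨j, hjd⟩, hj, ?_⟩
    · rintro i (hi | hi) <;> rw [α.coords_apply]
      exacts [h1 i hi.1 hi.2, h3 i hi.1 hi.2]
    · rwa [α.coords_apply]
    · rwa [α.coords_apply]
  · rintro ⟨h1, h2, j, hj, hj'⟩
    have hex : ∀ i : Fin d, extend y i = y i := fun i => dif_pos i.2
    have hmin : ∃ n, 2 * n < d ∧ extend y n ≠ 0 := by
      by_cases hkd : 2 * k < d
      · exact ⟨k, hkd, by rw [hex ⟨k, hlt⟩]; exact h2⟩
      · refine ⟨j, ?_, by rw [hex]; exact hj'⟩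
        have : (j : ℕ) ≤ d - k := hj
        omega
    obtain ⟨n, hn, hn'⟩ := hmin
    obtain ⟨α, hα⟩ := HeckeRep.exists_x_eq (extend y) hn hn'
    have hα' : ∀ i : Fin d, α.x i = y i := fun i => (hα i i.2).trans (hex i)
    refine ⟨α, ⟨fun i hi hp => ?_, ?_, fun i hi hp => ?_, j, hj, ?_⟩, ?_⟩
    · rw [hα' ⟨i, by omega⟩]
      exact h1 _ (Or.inl ⟨hi, hp⟩)
    · rw [hα' ⟨k, hlt⟩]
      exact h2
    · rw [hα' ⟨i, by omega⟩]
      exact h1 _ (Or.inr ⟨hi, hp⟩)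
    · rw [hα']
      exact hj'
    · funext i
      rw [α.coords_apply, hα']

theorem isLocallyClosedVar_of_coordinates {ι : Type} (J T : Set ι) (k : ι) :
    IsLocallyClosedVar {y : ι → ℂ | (∀ j ∈ J, y j = 0) ∧ y k ≠ 0 ∧ ∃ j ∈ T, y j ≠ 0} := by
  refine ⟨MvPolynomial.X '' J, (fun j => MvPolynomial.X k * MvPolynomial.X j) '' T, ?_⟩
  ext y
  simp only [Set.mem_ofPred_eq, Set.forall_mem_image, Set.exists_mem_image, map_mul,
    MvPolynomial.eval_X, mul_ne_zero_iff]
  refine and_congr_right fun _ => ⟨?_, ?_⟩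
  · rintro ⟨hk, j, hj, h⟩
    exact ⟨j, hj, hk, h⟩
  · rintro ⟨j, hj, hk, h⟩
    exact ⟨hk, j, hj, h⟩

theorem affine_zeros_countable {a b : ℂ} (ha : a ≠ 0) : {t : ℂ | a + t * b = 0}.Countable := by
  refine Set.Subsingleton.countable fun t ht u hu => ?_
  simp only [Set.mem_ofPred_eq] at ht hu
  have hb : b ≠ 0 := by
    rintro rfl
    exact ha (by rwa [mul_zero, add_zero] at ht)
  exact mul_right_cancel₀ hb (by linear_combination ht - hu)

/-- Two points are joined inside the complex line through them, from which at most two points have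
to be removed. -/
theorem isConnected_of_coordinates {ι : Type} {J T : Set ι} {k : ι}
    (hne : {y : ι → ℂ | (∀ j ∈ J, y j = 0) ∧ y k ≠ 0 ∧ ∃ j ∈ T, y j ≠ 0}.Nonempty) :
    IsConnected {y : ι → ℂ | (∀ j ∈ J, y j = 0) ∧ y k ≠ 0 ∧ ∃ j ∈ T, y j ≠ 0} := by
  set S := {y : ι → ℂ | (∀ j ∈ J, y j = 0) ∧ y k ≠ 0 ∧ ∃ j ∈ T, y j ≠ 0}
  refine ⟨hne, isPreconnected_of_forall_pair fun y hy u hu => ?_⟩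
  have hcont : Continuous fun (t : ℂ) (j : ι) => y j + t * (u j - y j) := by fun_prop
  set L : ℂ → ι → ℂ := fun t j => y j + t * (u j - y j)
  have hcount : (L ⁻¹' S)ᶜ.Countable := by
    obtain ⟨j, hjT, hj⟩ := hy.2.2
    refine ((affine_zeros_countable (b := u k - y k) hy.2.1).union
      (affine_zeros_countable (b := u j - y j) hj)).mono fun t ht => ?_
    by_contra hcon
    rw [Set.mem_union, not_or] at hcon
    refine ht ⟨fun i hi => ?_, hcon.1, j, hjT, hcon.2⟩
    change y i + t * (u i - y i) = 0
    rw [hy.1 i hi, hu.1 i hi, sub_zero, mul_zero, add_zero]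
  have hpath : IsPathConnected (L ⁻¹' S) := by
    have := hcount.isPathConnected_compl_of_one_lt_rank
      (by rw [Complex.rank_real_complex]; exact Cardinal.one_lt_two)
    rwa [compl_compl] at this
  have h0 : L 0 = y := by
    funext j
    simp [L]
  have h1 : L 1 = u := by
    funext j
    simp [L]
  refine ⟨L '' (L ⁻¹' S), Set.image_preimage_subset _ _, ⟨0, ?_, h0⟩, ⟨1, ?_, h1⟩,
    (hpath.isConnected.isPreconnected.image _ hcont.continuousOn)⟩
  · rwa [Set.mem_preimage, h0]
  · rwa [Set.mem_preimage, h1]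

theorem isRegular_chartCoord {d k s : ℕ} (hk : k < d) (i : ℕ) :
    IsRegular (MvPolynomial.X ⟨k, hk⟩) {y : Fin d → ℂ | y ⟨k, hk⟩ ≠ 0}
      fun y => chartCoord k s (extend y) i := by
  have hx : ∀ j, IsRegular (MvPolynomial.X ⟨k, hk⟩) {y : Fin d → ℂ | y ⟨k, hk⟩ ≠ 0}
      fun y => extend y j := by
    intro j
    by_cases hj : j < d
    · exact (IsRegular.eval (MvPolynomial.X ⟨j, hj⟩)).congr fun y _ => by
        rw [extend, dif_pos hj, MvPolynomial.eval_X]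
    · exact (IsRegular.const 0).congr fun y _ => by rw [extend, dif_neg hj]
  refine IsRegular.coeff_mul (fun l _ => ?_) fun l _ => IsRegular.coeff_inv (fun r _ => ?_) ?_
  · simpa only [coeff_ser] using hx _
  · simpa only [coeff_ser] using hx _
  · simp only [constantCoeff_ser]
    refine IsRegular.inv (IsRegular.const 1) (fun y hy => ?_) fun y hy => ?_
    · rwa [MvPolynomial.eval_X]
    · rw [mul_one, MvPolynomial.eval_X, extend, dif_pos hk]

/-! ### Charts as pieces of the quotient -/

open Classical in
/-- The chart with parameters `k`, `s` as a piece of `Heck_d / G_D`, mapped to the affine chart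
`{y_0 ≠ 0}` of a weighted projective space with weights `w`. -/
def chartPiece (d k s : ℕ) (w : ℕ → ℕ) : Piece d where
  reps := chartReps d k s
  m := (d - k - s) / 2
  weight := fun j => w j
  map := fun q => affinePoint (fun j => w j)
    (if h : ∃ α ∈ chartReps d k s, α.cls = q then chartCoord k s h.choose.x else 0)

section Pieces

variable {d k s k' s' : ℕ} {w w' : ℕ → ℕ}

open Classical in
theorem chartPiece_map_cls (hc : IsChart d k s) {α : HeckeRep d} (hα : α ∈ chartReps d k s) :
    (chartPiece d k s w).map α.cls =
      affinePoint (m := (d - k - s) / 2) (fun j => w j) (chartCoord k s α.x) := by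
  have h : ∃ β ∈ chartReps d k s, β.cls = α.cls := ⟨α, hα, rfl⟩
  change affinePoint _ (dite _ _ _) = _
  rw [dif_pos h]
  exact affinePoint_congr fun i hi =>
    chartCoord_eq_of_cls_eq hc h.choose_spec.1 hα h.choose_spec.2 hi

theorem chartPiece_image_inter (hc : IsChart d k s) {C : Set (HeckQuot d)} {Z U : Set ℕ}
    (h1 : ∀ α ∈ chartReps d k s, α.cls ∈ C → (∀ i < (d - k - s) / 2, i ∈ Z →
      chartCoord k s α.x i = 0) ∧ ∀ i < (d - k - s) / 2, i ∈ U → chartCoord k s α.x i ≠ 0)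
    (h2 : ∀ c : ℕ → ℂ, (∀ i < (d - k - s) / 2, i ∈ Z → c i = 0) →
      (∀ i < (d - k - s) / 2, i ∈ U → c i ≠ 0) → ∃ α ∈ chartReps d k s, α.cls ∈ C ∧
        ∀ i < (d - k - s) / 2, chartCoord k s α.x i = c i) :
    (chartPiece d k s w).map '' ((chartPiece d k s w).carrier ∩ C) =
      toricLocus (m := (d - k - s) / 2) (fun j => w j) Z U := by
  ext p
  constructor
  · rintro ⟨-, ⟨⟨α, hα, rfl⟩, hC⟩, rfl⟩
    exact ⟨_, (h1 α hα hC).1, (h1 α hα hC).2, chartPiece_map_cls hc hα⟩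
  · rintro ⟨c, hZ, hU, rfl⟩
    obtain ⟨α, hα, hC, hα'⟩ := h2 c hZ hU
    exact ⟨α.cls, ⟨⟨α, hα, rfl⟩, hC⟩, (chartPiece_map_cls hc hα).trans (affinePoint_congr hα')⟩

theorem chartPiece_image (hc : IsChart d k s) :
    (chartPiece d k s w).map '' (chartPiece d k s w).carrier =
      toricLocus (m := (d - k - s) / 2) (fun j => w j) ∅ ∅ := by
  rw [← Set.inter_univ (chartPiece d k s w).carrier]
  refine chartPiece_image_inter hc (fun _ _ _ => ⟨fun _ _ h => h.elim, fun _ _ h => h.elim⟩) ?_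
  intro c _ _
  obtain ⟨α, hα, h, -⟩ := exists_chartCoord_eq hc c
  exact ⟨α, hα, Set.mem_univ _, h⟩

theorem cone_chartPiece_image (hc : IsChart d k s) (hw : w 0 = 1) :
    WProj.cone ((chartPiece d k s w).map '' (chartPiece d k s w).carrier) = {y | y 0 ≠ 0} := by
  rw [chartPiece_image hc]
  refine (cone_toricLocus (m := (d - k - s) / 2) (w := fun j => w j) hw ∅ ∅).trans ?_
  ext y
  exact and_iff_left fun i => ⟨fun h => h.elim, fun h => h.elim⟩

theorem isToricPiece_chartPiece (hc : IsChart d k s) (hw0 : w 0 = 1) (hw : ∀ j, 1 ≤ w j) :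
    (chartPiece d k s w).IsToricPiece where
  stable φ α hα := smul_mem_chartReps hc φ hα
  locallyClosed := by
    change IsLocallyClosedVar (HeckeRep.coords '' chartReps d k s)
    rw [coords_image_chartReps hc]
    exact isLocallyClosedVar_of_coordinates _ _ _
  connected := by
    obtain ⟨α, hα, -⟩ := exists_chartCoord_eq hc 0
    have hne : (HeckeRep.coords '' chartReps d k s).Nonempty := ⟨_, α, hα, rfl⟩
    change IsConnected (HeckeRep.coords '' chartReps d k s)
    rw [coords_image_chartReps hc] at hne ⊢
    exact isConnected_of_coordinates hne
  algebraic := by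
    have hreg : ∀ j : Fin ((d - k - s) / 2 + 1), IsRegular (MvPolynomial.X ⟨k, hc.lt⟩)
        {y : Fin d → ℂ | y ⟨k, hc.lt⟩ ≠ 0} fun y => homog (chartCoord k s (extend y)) j := by
      intro j
      refine Fin.cases ?_ (fun i => ?_) j
      · simp only [Fin.val_zero, homog_zero]
        exact IsRegular.const 1
      · simp only [Fin.val_succ, homog_succ]
        exact isRegular_chartCoord hc.lt i
    obtain ⟨M, F, hF⟩ := IsRegular.exists_polynomial
      (w := fun j : Fin ((d - k - s) / 2 + 1) => w j) (fun j => hw j) hreg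
    refine ⟨F, fun α hα => ?_⟩
    have hk : α.coords ⟨k, hc.lt⟩ ≠ 0 := by
      rw [α.coords_apply]
      exact hα.2.1
    obtain ⟨hy, h⟩ := mk_eq_affinePoint (w := fun j : Fin ((d - k - s) / 2 + 1) => w j)
      (pow_ne_zero M (by rwa [MvPolynomial.eval_X])) (hF α.coords hk)
    rw [extend_coords] at h
    exact ⟨hy, (chartPiece_map_cls hc hα).trans h⟩
  separates := by
    rintro - ⟨α, hα, rfl⟩ - ⟨β, hβ, rfl⟩ h
    rw [chartPiece_map_cls hc hα, chartPiece_map_cls hc hβ] at h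
    exact cls_eq_of_chartCoord_eq hc hα hβ (affinePoint_injective hw0 h)
  toric := by
    rw [chartPiece_image hc]
    exact isToric_toricLocus (w := fun j : Fin ((d - k - s) / 2 + 1) => w j) hw0 ∅ ∅
  nonsingular := by
    rw [chartPiece_image hc]
    rintro - ⟨c, -, -, rfl⟩
    exact isNonsingular_affinePoint hw0 c

/-! ### Gluing of charts -/

open Classical in
/-- The product of the homogeneous coordinates that are invertible on `toricLocus w Z U`. -/
def unitProd {m : ℕ} (U : Set ℕ) : MvPolynomial (Fin (m + 1)) ℂ :=
  MvPolynomial.X 0 * ∏ i ∈ Finset.univ.filter fun i : Fin m => (i : ℕ) ∈ U, MvPolynomial.X i.succ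

open Classical in
theorem eval_unitProd_ne_zero {m : ℕ} {w : Fin (m + 1) → ℕ} (hw : w 0 = 1) {Z U : Set ℕ}
    {y : Fin (m + 1) → ℂ} (hy : y ∈ WProj.cone (toricLocus w Z U)) :
    MvPolynomial.eval y (unitProd U) ≠ 0 := by
  rw [cone_toricLocus hw] at hy
  rw [unitProd, map_mul, MvPolynomial.eval_X, map_prod]
  refine mul_ne_zero hy.1 (Finset.prod_ne_zero_iff.2 fun i hi => ?_)
  rw [MvPolynomial.eval_X]
  exact (hy.2 i).2 (Finset.mem_filter.1 hi).2

open Classical in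
theorem isRegular_inv_zero {m : ℕ} {w : Fin (m + 1) → ℕ} (hw : w 0 = 1) {Z U : Set ℕ} :
    IsRegular (unitProd U) (WProj.cone (toricLocus w Z U)) fun y => (y 0)⁻¹ := by
  refine IsRegular.inv (IsRegular.eval (∏ i ∈ Finset.univ.filter fun i : Fin m => (i : ℕ) ∈ U,
    MvPolynomial.X i.succ)) (fun y hy => eval_unitProd_ne_zero hw hy) fun y _ => ?_
  rw [unitProd, map_mul, MvPolynomial.eval_X]

open Classical in
theorem isRegular_inv_succ {m : ℕ} {w : Fin (m + 1) → ℕ} (hw : w 0 = 1) {Z U : Set ℕ} {i : Fin m}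
    (hi : (i : ℕ) ∈ U) :
    IsRegular (unitProd U) (WProj.cone (toricLocus w Z U)) fun y => (y i.succ)⁻¹ := by
  refine IsRegular.inv (IsRegular.eval (MvPolynomial.X 0 *
    ∏ i ∈ (Finset.univ.filter fun i : Fin m => (i : ℕ) ∈ U).erase i,
      MvPolynomial.X i.succ)) (fun y hy => eval_unitProd_ne_zero hw hy) fun y _ => ?_
  have h : unitProd U = MvPolynomial.X 0 * (MvPolynomial.X i.succ *
      ∏ i ∈ (Finset.univ.filter fun i : Fin m => (i : ℕ) ∈ U).erase i,
        (MvPolynomial.X i.succ : MvPolynomial (Fin (m + 1)) ℂ)) := by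
    rw [Finset.mul_prod_erase _ (fun i : Fin m => (MvPolynomial.X i.succ : MvPolynomial _ ℂ))
      (Finset.mem_filter.2 ⟨Finset.mem_univ i, hi⟩), unitProd]
  rw [h, map_mul, map_mul, map_mul, MvPolynomial.eval_X, MvPolynomial.eval_X]
  ring

theorem isRegular_affineCoord {m : ℕ} {w : Fin (m + 1) → ℕ} (hw : w 0 = 1) {Z U : Set ℕ}
    (i : ℕ) :
    IsRegular (unitProd U) (WProj.cone (toricLocus w Z U)) fun y => affineCoord w y i := by
  by_cases hi : i < m
  · refine ((IsRegular.eval (MvPolynomial.X (⟨i, hi⟩ : Fin m).succ)).mul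
      ((isRegular_inv_zero hw).pow (w (⟨i, hi⟩ : Fin m).succ))).congr fun y _ => ?_
    rw [affineCoord, dif_pos hi, MvPolynomial.eval_X, inv_pow, div_eq_mul_inv]
  · exact (IsRegular.const 0).congr fun y _ => by rw [affineCoord, dif_neg hi]

theorem isRegular_inv_affineCoord {m : ℕ} {w : Fin (m + 1) → ℕ} (hw : w 0 = 1) {Z U : Set ℕ}
    {i : ℕ} (hi : i < m) (hU : i ∈ U) :
    IsRegular (unitProd U) (WProj.cone (toricLocus w Z U)) fun y => (affineCoord w y i)⁻¹ := by
  refine ((IsRegular.eval (MvPolynomial.X 0 ^ w (⟨i, hi⟩ : Fin m).succ)).mul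
    (isRegular_inv_succ (i := ⟨i, hi⟩) hw hU)).congr fun y _ => ?_
  rw [affineCoord, dif_pos hi, map_pow, MvPolynomial.eval_X, inv_div, div_eq_mul_inv]

/-- Two charts are glued along a toric subspace if the overlap is given by the vanishing of some
coordinates and the nonvanishing of others, and if the coordinate change `g` is regular. -/
theorem gluesTo_of_overlap (hc : IsChart d k s) (hc' : IsChart d k' s') (hw0 : w 0 = 1)
    (hw' : ∀ j, 1 ≤ w' j) {Z U : Set ℕ} {g : (ℕ → ℂ) → ℕ → ℂ}
    (h1 : ∀ α ∈ chartReps d k s, ∀ β ∈ chartReps d k' s', α.cls = β.cls → ∀ c : ℕ → ℂ,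
      (∀ i < (d - k - s) / 2, chartCoord k s α.x i = c i) →
      (∀ i < (d - k - s) / 2, i ∈ Z → c i = 0) ∧ (∀ i < (d - k - s) / 2, i ∈ U → c i ≠ 0) ∧
      ∀ i < (d - k' - s') / 2, chartCoord k' s' β.x i = g c i)
    (h2 : ∀ c : ℕ → ℂ, (∀ i < (d - k - s) / 2, i ∈ Z → c i = 0) →
      (∀ i < (d - k - s) / 2, i ∈ U → c i ≠ 0) → ∃ α ∈ chartReps d k s, α ∈ chartReps d k' s' ∧
        ∀ i < (d - k - s) / 2, chartCoord k s α.x i = c i)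
    (hg : ∀ i < (d - k' - s') / 2, IsRegular (unitProd U)
      (WProj.cone (toricLocus (m := (d - k - s) / 2) (fun j => w j) Z U))
      fun y => g (affineCoord (fun j => w j) y) i) :
    (chartPiece d k s w).GluesTo (chartPiece d k' s' w') := by
  have himage : (chartPiece d k s w).map ''
      ((chartPiece d k s w).carrier ∩ (chartPiece d k' s' w').carrier) =
      toricLocus (m := (d - k - s) / 2) (fun j => w j) Z U := by
    refine chartPiece_image_inter hc ?_ ?_
    · rintro α hα ⟨β, hβ, h⟩
      have h3 := h1 α hα β hβ h.symm (chartCoord k s α.x) fun _ _ => rfl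
      exact ⟨h3.1, h3.2.1⟩
    · intro c hZ hU
      obtain ⟨α, hα, hα', hαc⟩ := h2 c hZ hU
      exact ⟨α, hα, ⟨α, hα', rfl⟩, hαc⟩
  constructor
  · rw [himage]
    exact isToric_toricLocus (w := fun j : Fin ((d - k - s) / 2 + 1) => w j) hw0 Z U
  · have hreg : ∀ j : Fin ((d - k' - s') / 2 + 1), IsRegular (unitProd U)
        (WProj.cone (toricLocus (m := (d - k - s) / 2) (fun j => w j) Z U))
        fun y => homog (g (affineCoord (fun j => w j) y)) j := by
      intro j
      refine Fin.cases ?_ (fun i => ?_) j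
      · simp only [Fin.val_zero, homog_zero]
        exact IsRegular.const 1
      · simp only [Fin.val_succ, homog_succ]
        exact hg i i.2
    obtain ⟨M, F, hF⟩ := IsRegular.exists_polynomial
      (w := fun j : Fin ((d - k' - s') / 2 + 1) => w' j) (fun j => hw' j) hreg
    refine ⟨F, ?_⟩
    rintro x hx y hy
    have hyS : y ∈ WProj.cone (toricLocus (m := (d - k - s) / 2) (fun j => w j) Z U) := by
      rw [← himage]
      obtain ⟨hy0, hy1⟩ := hy
      exact ⟨hy0, x, hx, (Set.mem_singleton_iff.1 hy1).symm⟩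
    obtain ⟨⟨α, hα, rfl⟩, β, hβ, hβα⟩ := hx
    rw [chartPiece_map_cls hc hα] at hy
    have hyα : ∀ i < (d - k - s) / 2, chartCoord k s α.x i = affineCoord (fun j => w j) y i :=
      fun i hi => (affineCoord_of_mem_cone (w := fun j : Fin ((d - k - s) / 2 + 1) => w j)
        hw0 hy hi).symm
    obtain ⟨hne, h⟩ := mk_eq_affinePoint (w := fun j : Fin ((d - k' - s') / 2 + 1) => w' j)
      (pow_ne_zero M (eval_unitProd_ne_zero
        (w := fun j : Fin ((d - k - s) / 2 + 1) => w j) hw0 hyS)) (hF y hyS)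
    refine ⟨hne, Eq.trans ?_ h⟩
    rw [← hβα, chartPiece_map_cls hc' hβ]
    exact affinePoint_congr (h1 α hα β hβ hβα.symm _ hyα).2.2

theorem gluesTo_of_disjoint
    (h : ∀ α ∈ chartReps d k s, ∀ β ∈ chartReps d k' s', α.cls ≠ β.cls) :
    (chartPiece d k s w).GluesTo (chartPiece d k' s' w') := by
  have hempty : (chartPiece d k s w).carrier ∩ (chartPiece d k' s' w').carrier = ∅ := by
    rw [Set.eq_empty_iff_forall_notMem]
    rintro - ⟨⟨α, hα, rfl⟩, β, hβ, hβα⟩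
    exact h α hα β hβ hβα.symm
  constructor
  · rw [hempty, Set.image_empty]
    exact isToric_empty
  · refine ⟨0, fun x hx => ?_⟩
    rw [hempty] at hx
    exact hx.elim

/-- Any two charts are glued algebraically along torus orbits. -/
theorem gluesTo_chartPiece (hc : IsChart d k s) (hc' : IsChart d k' s') (hw0 : w 0 = 1)
    (hw' : ∀ j, 1 ≤ w' j) : (chartPiece d k s w).GluesTo (chartPiece d k' s' w') := by
  have hpar := hc.parity
  have hpar' := hc'.parity
  have hodd := hc.odd
  by_cases hp : k % 2 = k' % 2
  · by_cases hk : k = k'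
    · subst hk
      refine gluesTo_of_overlap hc hc' hw0 hw' (Z := {i | s + 2 * i < s'}) (U := ∅)
        (g := fun c i => if s' + 2 * i < s then 0 else c ((s' + 2 * i - s) / 2)) ?_ ?_ ?_
      · intro α hα β hβ h c hcα
        obtain ⟨h1, h2⟩ := overlap_same hc hc' hα hβ h hcα
        exact ⟨h1, fun _ _ h => h.elim, h2⟩
      · intro c hZ _
        exact exists_mem_inter_same hc hc' hZ
      · intro i _
        by_cases hi : s' + 2 * i < s
        · simp only [hi, if_true]
          exact IsRegular.const 0
        · simp only [hi, if_false]
          exact isRegular_affineCoord hw0 _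
    · exact gluesTo_of_disjoint fun α hα β hβ h =>
        hk (eq_of_cls_eq_of_parity hc hc' hp hα hβ h)
  · by_cases hle : s ≤ k' ∧ s' ≤ k ∧ k + k' ≤ d
    · refine gluesTo_of_overlap hc hc' hw0 hw' (Z := {i | s + 2 * i < k'})
        (U := {i | s + 2 * i = k'})
        (g := fun c i => if s' + 2 * i < k then 0 else PowerSeries.coeff ((s' + 2 * i - k) / 2)
          (PowerSeries.mk fun l => c ((k' - s) / 2 + l))⁻¹) ?_ ?_ ?_
      · intro α hα β hβ h c hcα
        exact (overlap_opposite hc hc' hp hα hβ h hcα).2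
      · intro c hZ hU
        exact exists_mem_inter_opposite hc hc' hp hle.1 hle.2.1 hle.2.2 hZ hU
      · intro i hi
        by_cases hik : s' + 2 * i < k
        · simp only [hik, if_true]
          exact IsRegular.const 0
        · simp only [hik, if_false]
          refine IsRegular.coeff_inv (fun l _ => ?_) ?_
          · simp only [PowerSeries.coeff_mk]
            exact isRegular_affineCoord hw0 _
          · simp only [← PowerSeries.coeff_zero_eq_constantCoeff_apply, PowerSeries.coeff_mk]
            refine isRegular_inv_affineCoord hw0 (by omega) ?_
            change s + 2 * ((k' - s) / 2 + 0) = k'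
            omega
    · exact gluesTo_of_disjoint fun α hα β hβ h =>
        hle (overlap_opposite hc hc' hp hα hβ h fun _ _ => rfl).1

end Pieces

/-! ### The strata and the pieces that connect them -/

theorem isChart_stratum {d n : ℕ} (hd : Odd d) (hn : n < (d + 1) / 2) : IsChart d n (n + 1) := by
  have := Nat.odd_iff.1 hd
  exact ⟨this, by omega, by omega, by omega⟩

theorem isChart_full {d i : ℕ} (hd : Odd d) (hi : i < d - 2) : IsChart d (i + 1) (i % 2) := by
  have := Nat.odd_iff.1 hd
  exact ⟨this, by omega, by omega, by omega⟩

theorem chartReps_eq_stratum {d n : ℕ} (hd : Odd d) (hn : n < (d + 1) / 2) :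
    chartReps d n (n + 1) = stratum d n := by
  have := Nat.odd_iff.1 hd
  ext α
  refine Iff.trans ?_ (α.hasOrd_iff n).symm
  constructor
  · rintro ⟨h1, h2, h3, -⟩
    refine ⟨fun j hj => ?_, h2⟩
    by_cases hp : j % 2 = n % 2
    · exact h1 j hj hp
    · exact h3 j (by omega) (by omega)
  · rintro ⟨h1, h2⟩
    exact ⟨fun j hj _ => h1 j hj, h2, fun j hj hp => h1 j (by omega), n, by omega, h2⟩

/-- The full chart with distinguished entry of order `k` meets all strata `V_n` with `n` smaller
than `k` and `d - k` and of the other parity: it contains the class of `z ^ n + z ^ k`. -/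
theorem exists_mem_chartReps_stratum {d k s n : ℕ} (hc : IsChart d k s) (hs : s ≤ 1)
    (hnk : n < k) (hnd : n < d - k) (hp : n % 2 ≠ k % 2) :
    ∃ α ∈ chartReps d k s, α ∈ stratum d n := by
  have := hc.parity
  have := hc.lt
  obtain ⟨α, hα⟩ := HeckeRep.exists_x_eq (d := d) (fun j => if j = n ∨ j = k then 1 else 0)
    (n := n) (by omega) (by simp)
  have hz : ∀ j < d, j ≠ n → j ≠ k → α.x j = 0 := fun j hj h1 h2 => by
    rw [hα j hj, if_neg (by omega)]
  have hn : α.x n ≠ 0 := by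
    rw [hα n (by omega), if_pos (Or.inl rfl)]
    exact one_ne_zero
  have hk : α.x k ≠ 0 := by
    rw [hα k hc.lt, if_pos (Or.inr rfl)]
    exact one_ne_zero
  refine ⟨α, ⟨fun j hj hj' => hz j (by omega) ?_ (by omega), hk,
    fun j hj hj' => hz j (by omega) (by omega) (by omega), n, by omega, hn⟩,
    (α.hasOrd_iff n).2 ⟨fun j hj => hz j (by omega) (by omega) (by omega), hn⟩⟩
  rintro rfl
  exact hp hj'

/-- A representative of order `l` is equivalent to one with an entry of the other parity of some
order `k ≤ d - l`: the coefficient of index `d - l` does not affect the class and may be chosen to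
be nonzero. -/
theorem exists_equiv_mem_chartReps {d l : ℕ} (hd : Odd d) {α : HeckeRep d} (hl : 2 * l < d)
    (hl1 : 1 < l) (hα : α ∈ stratum d l) :
    ∃ k s, IsChart d k s ∧ s ≤ 1 ∧ l < k ∧ l ≤ d - k ∧ l % 2 ≠ k % 2 ∧
      ∃ β ∈ chartReps d k s, α ≈ β := by
  classical
  have hodd := Nat.odd_iff.1 hd
  obtain ⟨h0, h1⟩ := (α.hasOrd_iff l).1 hα
  obtain ⟨x, hx⟩ : ∃ x : ℕ → ℂ, x = fun j => if j < d - l then α.x j else 1 := ⟨_, rfl⟩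
  have hxj : ∀ j < d - l, x j = α.x j := fun j hj => by
    rw [hx]
    exact if_pos hj
  obtain ⟨β, hβ⟩ := HeckeRep.exists_x_eq (d := d) x hl (by rwa [hxj l (by omega)])
  have hβα : ∀ j < d - l, β.x j = α.x j := fun j hj => (hβ j (by omega)).trans (hxj j hj)
  have hβ0 : ∀ j < l, β.x j = 0 := fun j hj => (hβα j (by omega)).trans (h0 j hj)
  have hβl : β.x l ≠ 0 := by rwa [hβα l (by omega)]
  have hβd : β.x (d - l) ≠ 0 := by
    rw [hβ _ (by omega), hx]
    dsimp only
    rw [if_neg (lt_irrefl _)]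
    exact one_ne_zero
  have hex : ∃ k, k % 2 ≠ l % 2 ∧ β.x k ≠ 0 := ⟨d - l, by omega, hβd⟩
  obtain ⟨k, ⟨hk1, hk2⟩, hk3, hkd⟩ : ∃ k, (k % 2 ≠ l % 2 ∧ β.x k ≠ 0) ∧
      (∀ j < k, ¬ (j % 2 ≠ l % 2 ∧ β.x j ≠ 0)) ∧ k ≤ d - l :=
    ⟨Nat.find hex, Nat.find_spec hex, fun j hj => Nat.find_min hex hj,
      Nat.find_min' hex ⟨by omega, hβd⟩⟩
  have hlk : l < k := by
    rcases lt_trichotomy l k with h | h | h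
    · exact h
    · omega
    · exact absurd (hβ0 k h) hk2
  refine ⟨k, (k + 1) % 2, ⟨hodd, by omega, by omega, by omega⟩, by omega, hlk, by omega, hk1.symm,
    β, ⟨fun j hj hp => ?_, hk2, fun j hj _ => hβ0 j (by omega), l, by omega, hβl⟩,
    (HeckeRep.equiv_iff α β).2 ⟨l, hα, (β.hasOrd_iff l).2 ⟨hβ0, hβl⟩,
      fun j hj => (hβα j hj).symm⟩⟩
  by_contra hcon
  exact hk3 j hj ⟨by omega, hcon⟩

/-- Every parameter of a deeper stratum lies in a full chart that meets a given higher stratum. -/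
theorem exists_chart_connecting {d n l : ℕ} (hd : Odd d) (hnl : n < l) (hl : l < (d + 1) / 2)
    {α : HeckeRep d} (hα : α ∈ stratum d l) :
    ∃ i < d - 2, (∃ β ∈ chartReps d (i + 1) (i % 2), α ≈ β) ∧
      ∃ γ ∈ chartReps d (i + 1) (i % 2), γ ∈ stratum d n := by
  have hodd := Nat.odd_iff.1 hd
  by_cases hp : n % 2 = l % 2
  · obtain ⟨k, s, hc, hs, hlk, hld, hlk', β, hβ, hαβ⟩ :=
      exists_equiv_mem_chartReps hd (by omega) (by omega) hα
    have := hc.parity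
    have := hc.lt
    obtain ⟨i, rfl⟩ : ∃ i, k = i + 1 := ⟨k - 1, by omega⟩
    obtain rfl : s = i % 2 := by omega
    exact ⟨i, by omega, ⟨β, hβ, hαβ⟩,
      exists_mem_chartReps_stratum hc hs (by omega) (by omega) (by omega)⟩
  · obtain ⟨i, rfl⟩ : ∃ i, l = i + 1 := ⟨l - 1, by omega⟩
    have hc := isChart_full hd (i := i) (by omega)
    refine ⟨i, by omega, ⟨α, ?_, Setoid.refl α⟩,
      exists_mem_chartReps_stratum hc (by omega) (by omega) (by omega) hp⟩
    rw [← chartReps_eq_stratum hd hl] at hα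
    exact chartReps_mono (by omega) (by omega) hα

end HeckeModuli

end

open HeckeModuli in
theorem theorem7p5 (d : ℕ) (hd : Odd d) :
    ∃ (r : ℕ) (V : Fin ((d + 1) / 2) → Piece d) (N : Fin r → Piece d),
      -- the strata `V_n`, identified modulo `G_D` with affine charts of projective spaces
      (∀ n, (V n).IsToricPiece ∧ (V n).reps = stratum d n ∧
        (V n).m = (d - 2 * (n : ℕ) - 1) / 2 ∧ (V n).weight = (fun _ => 1) ∧
        WProj.cone ((V n).map '' (V n).carrier) = {y | y 0 ≠ 0}) ∧
      -- the pieces `N_i`, identified modulo `G_D` with toric subspaces of `P(1, 1, 2, …, m_i)`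
      (∀ i, (N i).IsToricPiece ∧ 1 ≤ (N i).m ∧ (N i).weight = weights (N i).m) ∧
      -- every parameter in a deeper stratum lies in a piece that meets a given higher stratum
      (∀ n l : Fin ((d + 1) / 2), n < l → ∀ α ∈ (V l).heckSet,
        ∃ i, α ∈ (N i).heckSet ∧ ((N i).heckSet ∩ (V n).heckSet).Nonempty) ∧
      -- the pieces cover the quotient
      (⋃ p : Fin ((d + 1) / 2) ⊕ Fin r, (Sum.elim V N p).carrier) = Set.univ ∧
      -- any two pieces are glued algebraically along torus orbits
      (∀ p q : Fin ((d + 1) / 2) ⊕ Fin r, (Sum.elim V N p).GluesTo (Sum.elim V N q)) := by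
  have hodd := Nat.odd_iff.1 hd
  have hw : ∀ j : ℕ, 1 ≤ max 1 j := fun j => le_max_left 1 j
  have hV := fun n : Fin ((d + 1) / 2) => isChart_stratum hd n.2
  have hN := fun i : Fin (d - 2) => isChart_full hd i.2
  have hreps := fun n : Fin ((d + 1) / 2) => chartReps_eq_stratum hd n.2
  refine ⟨d - 2, fun n => chartPiece d n (n + 1) fun _ => 1,
    fun i => chartPiece d (i + 1) (i % 2) fun j => max 1 j, fun n => ⟨?_, hreps n, ?_, rfl, ?_⟩,
    fun i => ⟨isToricPiece_chartPiece (hN i) rfl hw, ?_, rfl⟩, ?_, ?_, ?_⟩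
  · exact isToricPiece_chartPiece (hV n) rfl fun _ => le_rfl
  · change (d - n - (n + 1)) / 2 = _
    omega
  · exact cone_chartPiece_image (hV n) rfl
  · change 1 ≤ (d - (i + 1) - i % 2) / 2
    omega
  · rintro n l hnl - ⟨α, hα, rfl⟩
    obtain ⟨i, hi, ⟨β, hβ, hαβ⟩, γ, hγ, hγn⟩ :=
      exists_chart_connecting hd hnl l.2 (α := α) (by rw [← hreps l]; exact hα)
    rw [← hreps n] at hγn
    exact ⟨⟨i, hi⟩, ⟨β, hβ, (Quotient.sound hαβ).symm⟩, _, ⟨γ, hγ, rfl⟩, γ, hγn, rfl⟩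
  · rw [Set.eq_univ_iff_forall]
    intro q
    obtain ⟨h, rfl⟩ := Quotient.exists_rep q
    obtain ⟨α, rfl⟩ := Quotient.exists_rep h
    obtain ⟨n, hn, ho⟩ := α.ord_lt
    refine Set.mem_iUnion.2 ⟨Sum.inl ⟨n, by omega⟩, α, ?_, rfl⟩
    change α ∈ chartReps d n (n + 1)
    rwa [chartReps_eq_stratum hd (by omega)]
  · rintro (n | i) (n' | i')
    · exact gluesTo_chartPiece (hV n) (hV n') (w := fun _ => 1) rfl fun _ => le_rfl
    · exact gluesTo_chartPiece (hV n) (hN i') (w := fun _ => 1) rfl hw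
    · exact gluesTo_chartPiece (hN i) (hV n') rfl fun _ => le_rfl
    · exact gluesTo_chartPiece (hN i) (hN i') rfl hw
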